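/- Let $k\ge 2$ and $r\ge 1$ be integers with $k+r\ge 4$, and put $h:=k+r-1$ and $c:=\binom{k+r-2}{k-1}^{-1}$. A $k$-graph $H$ has a vertex set $V(H)$ and a set of edges, each of which is a $k$-element subset of $V(H)$; its minimum codegree $\delta_{k-1}(H)$ is the minimum, over all $(k-1)$-sets $S\subseteq V(H)$, of the number of vertices $v$ such that $S\cup\{v\}$ is an edge. An $(r,k)$-path in $H$ is a sequence of $m\ge h$ distinct vertices of $H$ such that all $k$-subsets of any $h$ consecutive vertices of the sequence are edges of $H$; its order is $m$, and its ends are the ordered $h$-tuples formed by its first $h$ and by its last $h$ vertices. $\mathbb G^{(k)}(n,p)$ denotes the random $k$-graph on a given $n$-element vertex set in which every $k$-set is an edge independently with probability $p$. There is $\alpha_0>0$ (depending on $k,r$) such that for every $0<\alpha\le\alpha_0$ there is $\zeta_0>0$ such that for every $0<\zeta\le\zeta_0$ there is $\varepsilon_0>0$ such that for every $0<\varepsilon\le\varepsilon_0$ the following holds. Let $H$ be an $n$-vertex $k$-graph with $$\delta_{k-1}(H)\ge(1-c+\alpha)n$$ and let $n^{-c-\varepsilon}\le p\le 1$. Then,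 with probability tending to $1$ as $n\to\infty$ (uniformly over all such $H$ and $p$), the $k$-graph $H\cup\mathbb G^{(k)}(n,p)$, where $\mathbb G^{(k)}(n,p)$ is taken on $V(H)$, contains an $(r,k)$-path $P_{\mathrm{abs}}$ of order at most $6h\zeta n$ such that, for every set $X\subseteq V(H)\setminus V(P_{\mathrm{abs}})$ with $|X|\le\zeta^2n/(2h)^2$, there is an $(r,k)$-path in $H\cup\mathbb G^{(k)}(n,p)$ with vertex set exactly $V(P_{\mathrm{abs}})\cup X$ that has the same ends as $P_{\mathrm{abs}}$. -/

import Mathlib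

/-!
A `k`-graph on a vertex type `V` is given by its edge set `H : Set (Finset V)`, all of whose
members have exactly `k` elements, that is, `H.Sized k`. The union of two `k`-graphs on the same
vertex set is then the union of the edge sets.
-/

namespace PerturbedHypergraph

variable {V : Type*}

/-- The degree of a vertex set `S` in the `k`-graph `H`: the number of `(k - |S|)`-sets `T`
with `S ∪ T` an edge. -/
noncomputable def degree [DecidableEq V] (k : ℕ) (H : Set (Finset V)) (S : Finset V) : ℕ :=
  {T : Finset V | T.card = k - S.card ∧ S ∪ T ∈ H}.ncard

/-- The minimum `d`-degree of the `k`-graph `H`: the minimum of the degrees of all `d`-sets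
of vertices. -/
noncomputable def minDegree [DecidableEq V] (k d : ℕ) (H : Set (Finset V)) : ℕ :=
  sInf {m : ℕ | ∃ S : Finset V, S.card = d ∧ degree k H S = m}

/-- The minimum codegree of the `k`-graph `H` is its minimum `(k - 1)`-degree. -/
noncomputable def minCodegree [DecidableEq V] (k : ℕ) (H : Set (Finset V)) : ℕ :=
  minDegree k (k - 1) H

/-- `P` lists, in order, the vertices of an `(r,k)`-path contained in the `k`-graph `H` (the `r`-th
power of a `k`-uniform tight path, as a not necessarily induced subgraph): there are at least
`k + r - 1` vertices, they are distinct, and any `k + r - 1` consecutive ones span a complete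
`k`-graph in `H`. -/
def IsPath (r k : ℕ) (H : Set (Finset V)) (P : List V) : Prop :=
  k + r - 1 ≤ P.length ∧ P.Nodup ∧
    ∀ W : List V, W <:+: P → W.length = k + r - 1 →
      ∀ e : Finset V, e.card = k → (∀ v ∈ e, v ∈ W) → e ∈ H

/-- Two `(r,k)`-paths have the same ends: their first `k + r - 1` vertices agree, in order,
and so do their last `k + r - 1` vertices. -/
def SameEnds (r k : ℕ) (P Q : List V) : Prop :=
  P.take (k + r - 1) = Q.take (k + r - 1) ∧ P.rtake (k + r - 1) = Q.rtake (k + r - 1)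

/-- The law of the binomial random `k`-graph on the vertex set `V`: each `k`-set is an edge
independently with probability `p`, and no other set is an edge. -/
noncomputable def binomialRandom (V : Type*) (k : ℕ) (p : unitInterval) :
    MeasureTheory.Measure (Set (Finset V)) :=
  ProbabilityTheory.setBernoulli {e : Finset V | e.card = k} p

/-- `P` is an absorbing `(r,k)`-path in the `k`-graph `H` for vertex sets of size at most `s`:
it is an `(r,k)`-path in `H` and, for every set `X` of at most `s` vertices outside `P`, there is
an `(r,k)`-path in `H` with vertex set `V(P) ∪ X` and with the same ends as `P`. -/
def IsAbsorbingPath [DecidableEq V] (r k : ℕ) (H : Set (Finset V)) (s : ℝ) (P : List V) : Prop :=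
  IsPath r k H P ∧
    ∀ X : Finset V, Disjoint X P.toFinset → (X.card : ℝ) ≤ s →
      ∃ Q : List V, IsPath r k H Q ∧ Q.toFinset = P.toFinset ∪ X ∧ SameEnds r k P Q

end PerturbedHypergraph

/-! The absorbing path is a concatenation of blocks of `3 * h` vertices, each put in front of the
path `P` built so far. All `k`-sets in windows inside a block are edges of `G`. Edges of `H` join
the last `h` vertices of the block to `P`, and the first `2 * h` vertices form a path in the link of
`v` in `H`. Then `v` may be inserted after the first `h` vertices: edges through `v` come from `H`,
and windows that skip `v` only get shorter in the block, so their other edges are still in `G`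
(`suffixChain_insert_of_blockStep`).

Choosing a block vertex by vertex from its end, each vertex faces at most `D = (h - 1).choose (k -
1)` codegree conditions. Each condition excludes at most `(1 / D - α) * n` vertices, so every `v`
has at least `β * n ^ (3 * h)` candidate blocks, regardless of `G` (`card_blocks_ge`). To serve all
vertices at once, each vertex has weight `2 ^ (-a)`, where `a` counts its absorbers. By averaging, a
positive proportion of tuples absorb at least a `β / 2` share of the total weight
(`card_heavyBlocks_ge`). Taking such a block each time makes the total weight decay exponentially,
so after about `ζ * n` blocks every vertex has linearly many absorbers (`card_absorbers_ge`), and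
Hall's theorem assigns distinct blocks to the vertices of `X`.

The blocks must also be present in `G`. Subgraphs of an `(r,k)`-path are sparse enough for Janson's
inequality to bound the probability that `G` misses a dense family of tuples by `exp (-C * n ^ (5 /
4))` (`binomialRandom_no_path_le`). This beats the `exp (O(n log n))` possible histories, so one
union bound handles the adaptive choice without exposing `G` in rounds. -/

open Finset

namespace PerturbedHypergraph

/-! ### Janson's inequality for binomial random subsets -/

section Janson
variable {β ι : Type*} [DecidableEq β]

/-- The probability that the binomial random subset of `U` equals `S`. -/
noncomputable def bernoulliWeight (U : Finset β) (p : ℝ) (S : Finset β) : ℝ :=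
  if S ⊆ U then p ^ #S * (1 - p) ^ #(U \ S) else 0

/-- The expectation of `f` over the binomial random subset of `U`. -/
noncomputable def bernoulliExp (U : Finset β) (p : ℝ) (f : Finset β → ℝ) : ℝ :=
  ∑ S ∈ U.powerset, bernoulliWeight U p S * f S

lemma bernoulliWeight_nonneg {U : Finset β} {p : ℝ} (hp : 0 ≤ p) (hp1 : p ≤ 1) (S : Finset β) :
    0 ≤ bernoulliWeight U p S := by
  unfold bernoulliWeight
  have : 0 ≤ 1 - p := by linarith
  split_ifs <;> positivity

lemma bernoulliWeight_insert_of_notMem {U : Finset β} {p : ℝ} {a : β} (ha : a ∉ U) {S : Finset β}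
    (hS : S ⊆ U) : bernoulliWeight (insert a U) p S = (1 - p) * bernoulliWeight U p S := by
  have haS : a ∉ S := fun h => ha (hS h)
  rw [bernoulliWeight, bernoulliWeight, if_pos hS, if_pos (hS.trans (subset_insert _ _)),
    insert_sdiff_of_notMem _ haS, card_insert_of_notMem (by simp [ha]), pow_succ]
  ring

lemma bernoulliWeight_insert_insert {U : Finset β} {p : ℝ} {a : β} (ha : a ∉ U) {S : Finset β}
    (hS : S ⊆ U) : bernoulliWeight (insert a U) p (insert a S) = p * bernoulliWeight U p S := by
  have haS : a ∉ S := fun h => ha (hS h)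
  have : insert a U \ insert a S = U \ S := by
    ext x; simp only [mem_sdiff, mem_insert]; grind
  rw [bernoulliWeight, bernoulliWeight, if_pos hS, if_pos (insert_subset_insert _ hS), this,
    card_insert_of_notMem haS, pow_succ]
  ring

lemma bernoulliExp_insert {U : Finset β} {p : ℝ} {a : β} (ha : a ∉ U) (f : Finset β → ℝ) :
    bernoulliExp (insert a U) p f =
      bernoulliExp U p fun S => (1 - p) * f S + p * f (insert a S) := by
  unfold bernoulliExp
  rw [sum_powerset_insert ha, ← sum_add_distrib]
  refine sum_congr rfl fun S hS => ?_
  rw [mem_powerset] at hS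
  rw [bernoulliWeight_insert_of_notMem ha hS, bernoulliWeight_insert_insert ha hS]
  ring

lemma bernoulliExp_one (U : Finset β) (p : ℝ) : bernoulliExp U p (fun _ => 1) = 1 := by
  induction U using Finset.induction_on with
  | empty => simp [bernoulliExp, bernoulliWeight]
  | insert a U ha ih => rw [bernoulliExp_insert ha]; simpa using ih

lemma bernoulliExp_mem_mul {U : Finset β} {p : ℝ} {a : β} (ha : a ∈ U) (f : Finset β → ℝ)
    (hf : ∀ S, f (insert a S) = f S) :
    bernoulliExp U p (fun S => (if a ∈ S then 1 else 0) * f S) = p * bernoulliExp U p f := by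
  obtain ⟨U, haU, rfl⟩ : ∃ U', a ∉ U' ∧ U = insert a U' :=
    ⟨U.erase a, notMem_erase _ _, (insert_erase ha).symm⟩
  rw [bernoulliExp_insert haU, bernoulliExp_insert haU]
  unfold bernoulliExp
  rw [mul_sum]
  refine sum_congr rfl fun S hS => ?_
  have : a ∉ S := fun h => haU (mem_powerset.1 hS h)
  simp [this, hf]
  ring

/-- Independence: `hf` says that `f` ignores the elements of `A`. -/
lemma bernoulliExp_subset_mul {U A : Finset β} {p : ℝ} (hA : A ⊆ U) (f : Finset β → ℝ)
    (hf : ∀ a ∈ A, ∀ S, f (insert a S) = f S) :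
    bernoulliExp U p (fun S => (if A ⊆ S then 1 else 0) * f S) = p ^ #A * bernoulliExp U p f := by
  induction A using Finset.induction_on with
  | empty => simp
  | insert a A ha ih =>
    have h1 : ∀ S : Finset β, (if insert a A ⊆ S then (1 : ℝ) else 0) * f S =
        (if a ∈ S then 1 else 0) * ((if A ⊆ S then 1 else 0) * f S) := by
      intro S
      by_cases h1 : a ∈ S <;> by_cases h2 : A ⊆ S <;> simp [insert_subset_iff, h1, h2]
    simp_rw [h1]
    rw [bernoulliExp_mem_mul (hA (mem_insert_self _ _)), ih ((subset_insert _ _).trans hA)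
      (fun b hb => hf b (mem_insert_of_mem hb)), card_insert_of_notMem ha, pow_succ]
    · ring
    · intro S
      rw [hf a (mem_insert_self _ _)]
      simp [subset_insert_iff_of_notMem ha]

lemma bernoulliExp_subset {U A : Finset β} {p : ℝ} (hA : A ⊆ U) :
    bernoulliExp U p (fun S => if A ⊆ S then 1 else 0) = p ^ #A := by
  simpa [bernoulliExp_one] using bernoulliExp_subset_mul (p := p) hA (fun _ => 1) (by simp)

lemma bernoulliExp_mono {U : Finset β} {p : ℝ} (hp : 0 ≤ p) (hp1 : p ≤ 1) {f g : Finset β → ℝ}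
    (hfg : ∀ S, f S ≤ g S) : bernoulliExp U p f ≤ bernoulliExp U p g :=
  sum_le_sum fun S _ => mul_le_mul_of_nonneg_left (hfg S) (bernoulliWeight_nonneg hp hp1 S)

lemma bernoulliExp_nonneg {U : Finset β} {p : ℝ} (hp : 0 ≤ p) (hp1 : p ≤ 1) {f : Finset β → ℝ}
    (hf : ∀ S, 0 ≤ f S) : 0 ≤ bernoulliExp U p f :=
  sum_nonneg fun S _ => mul_nonneg (bernoulliWeight_nonneg hp hp1 S) (hf S)

lemma bernoulliExp_sum {U : Finset β} {p : ℝ} (I : Finset ι) (f : ι → Finset β → ℝ) :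
    bernoulliExp U p (fun S => ∑ i ∈ I, f i S) = ∑ i ∈ I, bernoulliExp U p (f i) := by
  unfold bernoulliExp
  rw [sum_comm]
  simp_rw [mul_sum]

/-- Product measures are log-modular; this supplies the lattice condition of the FKG inequality. -/
lemma bernoulliWeight_mul (U S T : Finset β) {p : ℝ} (hS : S ⊆ U) (hT : T ⊆ U) :
    bernoulliWeight U p S * bernoulliWeight U p T =
      bernoulliWeight U p (S ∩ T) * bernoulliWeight U p (S ∪ T) := by
  simp only [bernoulliWeight, if_pos hS, if_pos hT, if_pos (inter_subset_left.trans hS),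
    if_pos (union_subset hS hT)]
  have h1 := card_union_add_card_inter S T
  have h2 := card_union_add_card_inter (U \ S) (U \ T)
  have h3 : U \ S ∪ U \ T = U \ (S ∩ T) := by ext; simp only [mem_union, mem_sdiff, mem_inter]; tauto
  have h4 : U \ S ∩ (U \ T) = U \ (S ∪ T) := by ext; simp only [mem_union, mem_sdiff, mem_inter]; tauto
  rw [h3, h4] at h2
  calc _ = p ^ (#S + #T) * (1 - p) ^ (#(U \ S) + #(U \ T)) := by ring
    _ = _ := by rw [← h1, ← h2]; ring

/-- Harris' inequality for two decreasing functions, conditioned on the event that the random set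
contains `A`. -/
lemma bernoulliExp_harris [Fintype β] {U : Finset β} {p : ℝ} (hp : 0 ≤ p) (hp1 : p ≤ 1)
    (A : Finset β) {f g : Finset β → ℝ} (hf0 : ∀ S, 0 ≤ f S) (hg0 : ∀ S, 0 ≤ g S)
    (hf : Antitone f) (hg : Antitone g) :
    bernoulliExp U p (fun S => (if A ⊆ S then 1 else 0) * f S) *
      bernoulliExp U p (fun S => (if A ⊆ S then 1 else 0) * g S) ≤
    bernoulliExp U p (fun S => if A ⊆ S then 1 else 0) *
      bernoulliExp U p (fun S => (if A ⊆ S then 1 else 0) * (f S * g S)) := by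
  let w : Finset β → ℝ := fun S => bernoulliWeight U p S * (if A ⊆ S then 1 else 0)
  have hw0 : ∀ S, 0 ≤ w S := fun S =>
    mul_nonneg (bernoulliWeight_nonneg hp hp1 S) (by split_ifs <;> norm_num)
  have key : ∀ F : Finset β → ℝ,
      bernoulliExp U p (fun S => (if A ⊆ S then 1 else 0) * F S) = ∑ S, w S * F S := by
    intro F
    unfold bernoulliExp
    rw [← sum_subset (subset_univ U.powerset)]
    · exact sum_congr rfl fun S _ => by simp only [w]; ring
    · intro S _ hS
      rw [mem_powerset] at hS
      simp [w, bernoulliWeight, hS]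
  have key1 : bernoulliExp U p (fun S => if A ⊆ S then 1 else 0) = ∑ S, w S := by
    simpa using key (fun _ => 1)
  rw [key, key, key, key1]
  have hmod : ∀ S T : Finset β, w S * w T ≤ w (S ∪ T) * w (S ∩ T) := by
    intro S T
    by_cases hS : S ⊆ U ∧ A ⊆ S
    · by_cases hT : T ⊆ U ∧ A ⊆ T
      · simp only [w, if_pos hS.2, if_pos hT.2, if_pos (subset_inter hS.2 hT.2),
          if_pos (hS.2.trans subset_union_left), mul_one]
        rw [bernoulliWeight_mul U S T hS.1 hT.1, mul_comm]
      · have : w T = 0 := by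
          by_cases h : T ⊆ U
          · simp only [w, if_neg fun h' => hT ⟨h, h'⟩, mul_zero]
          · simp [w, bernoulliWeight, h]
        rw [this, mul_zero]
        exact mul_nonneg (hw0 _) (hw0 _)
    · have : w S = 0 := by
        by_cases h : S ⊆ U
        · simp only [w, if_neg fun h' => hS ⟨h, h'⟩, mul_zero]
        · simp [w, bernoulliWeight, h]
      rw [this, zero_mul]
      exact mul_nonneg (hw0 _) (hw0 _)
  -- The order dual turns decreasing functions into the increasing ones that `fkg` expects.
  exact fkg (α := (Finset β)ᵒᵈ) (μ := fun S => w (OrderDual.ofDual S))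
    (f := fun S => f (OrderDual.ofDual S)) (g := fun S => g (OrderDual.ofDual S))
    (fun S => hw0 _) (fun S => hf0 _) (fun S => hg0 _) (fun S T h => hf h) (fun S T h => hg h)
    (fun S T => hmod _ _)

variable (A : ι → Finset β) (I : Finset ι)

/-- The number of indices in `I` whose set is contained in `S`. -/
noncomputable def copyCount (S : Finset β) : ℝ := ∑ i ∈ I, if A i ⊆ S then 1 else 0

lemma copyCount_mono : Monotone (copyCount A I) := by
  intro S T hST
  refine sum_le_sum fun i _ => ?_
  by_cases h : A i ⊆ S
  · simp [h, h.trans hST]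
  · simp only [h, if_false]; split_ifs <;> norm_num

lemma copyCount_nonneg (S : Finset β) : 0 ≤ copyCount A I S :=
  sum_nonneg fun i _ => by split_ifs <;> norm_num

/-- One term of the lower bound for the logarithmic derivative of the Laplace transform. -/
lemma bernoulliExp_exp_copyCount_ge [Fintype β] {U : Finset β} {p s : ℝ} (hp : 0 < p) (hp1 : p ≤ 1)
    (hs : 0 ≤ s) (hA : ∀ i ∈ I, A i ⊆ U) {i : ι} (hi : i ∈ I) :
    (p ^ #(A i) - s * ∑ j ∈ I with ¬ Disjoint (A i) (A j), p ^ #(A i ∪ A j)) *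
        bernoulliExp U p (fun S => Real.exp (-(s * copyCount A I S))) ≤
      bernoulliExp U p
        (fun S => (if A i ⊆ S then 1 else 0) * Real.exp (-(s * copyCount A I S))) := by
  classical
  -- Copies meeting `A i` are separated from those disjoint from it. Harris decouples the two
  -- groups, and the second is independent of the event `A i ⊆ S`.
  set J := I.filter (fun j => ¬ Disjoint (A i) (A j)) with hJ
  set K := I.filter (fun j => Disjoint (A i) (A j)) with hK
  have hsplit : ∀ S, copyCount A I S = copyCount A J S + copyCount A K S := by
    intro S
    simp only [copyCount]
    rw [add_comm, sum_filter_add_sum_filter_not]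
  have hanti : ∀ L : Finset ι, Antitone fun S => Real.exp (-(s * copyCount A L S)) := by
    intro L S T hST
    have := mul_le_mul_of_nonneg_left (copyCount_mono A L hST) hs
    exact Real.exp_le_exp.2 (by linarith)
  have hH := bernoulliExp_harris (U := U) hp.le hp1 (A i) (fun S => (Real.exp_pos _).le)
    (fun S => (Real.exp_pos _).le) (hanti J) (hanti K)
  have hexp : ∀ S, Real.exp (-(s * copyCount A J S)) * Real.exp (-(s * copyCount A K S)) =
      Real.exp (-(s * copyCount A I S)) := by
    intro S; rw [← Real.exp_add, hsplit]; ring_nf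
  simp_rw [hexp] at hH
  rw [bernoulliExp_subset (hA i hi)] at hH
  have hind : bernoulliExp U p
      (fun S => (if A i ⊆ S then 1 else 0) * Real.exp (-(s * copyCount A K S))) =
      p ^ #(A i) * bernoulliExp U p (fun S => Real.exp (-(s * copyCount A K S))) := by
    refine bernoulliExp_subset_mul (hA i hi) _ fun a ha S => ?_
    congr 3
    refine sum_congr rfl fun j hj => ?_
    have : a ∉ A j := disjoint_left.1 (mem_filter.1 hj).2 ha
    simp [subset_insert_iff_of_notMem this]
  rw [hind] at hH
  have hpA : 0 < p ^ #(A i) := pow_pos hp _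
  set X := bernoulliExp U p
    (fun S => (if A i ⊆ S then 1 else 0) * Real.exp (-(s * copyCount A J S))) with hX
  set Z := bernoulliExp U p (fun S => Real.exp (-(s * copyCount A K S))) with hZ
  set Y := bernoulliExp U p (fun S => Real.exp (-(s * copyCount A I S))) with hY
  have hX0 : 0 ≤ X := bernoulliExp_nonneg hp.le hp1 fun S =>
    mul_nonneg (by split_ifs <;> norm_num) (Real.exp_pos _).le
  have hY0 : 0 ≤ Y := bernoulliExp_nonneg hp.le hp1 fun S => (Real.exp_pos _).le
  have hYZ : Y ≤ Z := by
    refine bernoulliExp_mono hp.le hp1 fun S => Real.exp_le_exp.2 ?_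
    have := mul_nonneg hs (copyCount_nonneg A J S)
    rw [hsplit]
    linarith
  have h1 : X * Z ≤ bernoulliExp U p
        (fun S => (if A i ⊆ S then 1 else 0) * Real.exp (-(s * copyCount A I S))) := by
    refine le_of_mul_le_mul_left ?_ hpA
    linarith
  -- From `exp (-x) ≥ 1 - x` applied to the overlapping copies.
  have h2 : p ^ #(A i) - s * ∑ j ∈ J, p ^ #(A i ∪ A j) ≤ X := by
    have e1 : bernoulliExp U p (fun S => (if A i ⊆ S then 1 else 0) -
        s * ∑ j ∈ J, (if A i ∪ A j ⊆ S then 1 else 0)) =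
        p ^ #(A i) - s * ∑ j ∈ J, p ^ #(A i ∪ A j) := by
      have : ∑ j ∈ J, p ^ #(A i ∪ A j) =
          ∑ j ∈ J, bernoulliExp U p (fun S => if A i ∪ A j ⊆ S then 1 else 0) :=
        sum_congr rfl fun j hj => (bernoulliExp_subset
          (union_subset (hA i hi) (hA j (mem_filter.1 hj).1))).symm
      rw [this, ← bernoulliExp_subset (p := p) (hA i hi), ← bernoulliExp_sum]
      unfold bernoulliExp
      rw [mul_sum, ← sum_sub_distrib]
      exact sum_congr rfl fun S _ => by ring
    rw [← e1]
    refine bernoulliExp_mono hp.le hp1 fun S => ?_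
    by_cases h : A i ⊆ S
    · simp only [h, if_true, one_mul, union_subset_iff, true_and]
      have := Real.add_one_le_exp (-(s * copyCount A J S))
      simp only [copyCount] at this ⊢
      linarith
    · simp [h, union_subset_iff]
  calc _ ≤ X * Y := mul_le_mul_of_nonneg_right h2 hY0
    _ ≤ X * Z := mul_le_mul_of_nonneg_left hYZ hX0
    _ ≤ _ := h1

/-- Janson's inequality, before optimising in `s`. -/
theorem bernoulliExp_no_copy_le [Fintype β] {U : Finset β} {p s : ℝ} (hp : 0 < p) (hp1 : p ≤ 1)
    (hs : 0 ≤ s) (hA : ∀ i ∈ I, A i ⊆ U) :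
    bernoulliExp U p (fun S => if ∀ i ∈ I, ¬ A i ⊆ S then 1 else 0) ≤
      Real.exp (-(s * ∑ i ∈ I, p ^ #(A i)) +
        s ^ 2 / 2 * ∑ i ∈ I, ∑ j ∈ I with ¬ Disjoint (A i) (A j), p ^ #(A i ∪ A j)) := by
  classical
  set m := ∑ i ∈ I, p ^ #(A i) with hm
  set D := ∑ i ∈ I, ∑ j ∈ I with ¬ Disjoint (A i) (A j), p ^ #(A i ∪ A j) with hD
  let Ψ : ℝ → ℝ := fun t => bernoulliExp U p (fun S => Real.exp (-(t * copyCount A I S)))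
  let Ψ' : ℝ → ℝ := fun t =>
    -bernoulliExp U p (fun S => copyCount A I S * Real.exp (-(t * copyCount A I S)))
  have hderiv : ∀ t, HasDerivAt Ψ (Ψ' t) t := by
    intro t
    have : Ψ' t = ∑ S ∈ U.powerset, bernoulliWeight U p S *
        (Real.exp (-(t * copyCount A I S)) * -(1 * copyCount A I S)) := by
      simp only [Ψ', bernoulliExp]
      rw [← sum_neg_distrib]
      exact sum_congr rfl fun S _ => by ring
    rw [this]
    refine HasDerivAt.fun_sum fun S _ => HasDerivAt.const_mul _ ?_
    exact (((hasDerivAt_id t).mul_const _).neg).exp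
  have hΨ' : ∀ t, 0 ≤ t → Ψ' t ≤ -(m - t * D) * Ψ t := by
    intro t ht
    have h1 : bernoulliExp U p
        (fun S => copyCount A I S * Real.exp (-(t * copyCount A I S))) =
        ∑ i ∈ I, bernoulliExp U p
          (fun S => (if A i ⊆ S then 1 else 0) * Real.exp (-(t * copyCount A I S))) := by
      rw [← bernoulliExp_sum]
      unfold bernoulliExp
      refine sum_congr rfl fun S _ => ?_
      simp only [copyCount, sum_mul]
    have h2 := sum_le_sum fun i (hi : i ∈ I) =>
      bernoulliExp_exp_copyCount_ge A I hp hp1 ht hA hi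
    rw [← h1, ← sum_mul, sum_sub_distrib, ← mul_sum] at h2
    simp only [Ψ', Ψ]
    linarith
  -- Integrating factor for `hΨ'`: the differential inequality says exactly that `Φ` is
  -- nonincreasing on `t ≥ 0`.
  let Φ : ℝ → ℝ := fun t => Ψ t * Real.exp (t * m - t ^ 2 / 2 * D)
  have hΦ : ∀ t, HasDerivAt Φ (Ψ' t * Real.exp (t * m - t ^ 2 / 2 * D) +
      Ψ t * (Real.exp (t * m - t ^ 2 / 2 * D) * (m - t * D))) t := by
    intro t
    refine (hderiv t).mul (HasDerivAt.exp ?_)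
    refine (((hasDerivAt_id' t).mul_const m).fun_sub
      (((hasDerivAt_pow 2 t).div_const 2).mul_const D)).congr_deriv ?_
    simp
  have hanti : AntitoneOn Φ (Set.Ici 0) := by
    refine antitoneOn_of_deriv_nonpos (convex_Ici 0)
      (fun t _ => (hΦ t).continuousAt.continuousWithinAt)
      (fun t _ => (hΦ t).differentiableAt.differentiableWithinAt) fun t ht => ?_
    rw [interior_Ici] at ht
    rw [(hΦ t).deriv]
    have := mul_le_mul_of_nonneg_right (hΨ' t (le_of_lt ht))
      (Real.exp_pos (t * m - t ^ 2 / 2 * D)).le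
    linarith
  have h0 : Φ 0 = 1 := by simp [Φ, Ψ, bernoulliExp_one]
  have h1 : Φ s ≤ 1 := h0 ▸ hanti (Set.mem_Ici.2 le_rfl) hs hs
  have h2 : Ψ s ≤ Real.exp (-(s * m) + s ^ 2 / 2 * D) := by
    have h3 : Ψ s = Φ s * Real.exp (-(s * m) + s ^ 2 / 2 * D) := by
      simp only [Φ]
      rw [mul_assoc, ← Real.exp_add]
      ring_nf
      simp
    rw [h3]
    exact mul_le_of_le_one_left (Real.exp_pos _).le h1
  refine le_trans (bernoulliExp_mono hp.le hp1 fun S => ?_) h2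
  split_ifs with h
  · have : copyCount A I S = 0 := sum_eq_zero fun i hi => if_neg (h i hi)
    simp [this]
  · exact (Real.exp_pos _).le

end Janson

/-! ### Density of subgraphs of an `(r,k)`-path -/

section PathEdges

/-- The edges of the `(r,k)`-path with vertices `0, …, M - 1`, where `h = k + r - 1`. -/
def pathEdges (k h M : ℕ) : Finset (Finset (Fin M)) :=
  univ.filter fun e => #e = k ∧ ∀ a ∈ e, ∀ b ∈ e, (b : ℕ) < a + h

lemma card_filter_window_le {M h : ℕ} (J : Finset (Fin M)) (j : Fin M) (hJ : ∀ i ∈ J, i < j) :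
    #(J.filter fun i : Fin M => (j : ℕ) < i + h) ≤ h - 1 := by
  calc #(J.filter fun i : Fin M => (j : ℕ) < i + h) ≤ #(Ico ((j : ℕ) + 1 - h) j) := by
        refine card_le_card_of_injOn (fun i => (i : ℕ)) ?_ fun a _ b _ hab => Fin.ext hab
        intro i hi
        simp only [coe_filter, Set.mem_ofPred_eq] at hi
        have := Fin.lt_def.1 (hJ i hi.1)
        simp only [coe_Ico, Set.mem_Ico]
        omega
    _ ≤ h - 1 := by rw [Nat.card_Ico]; omega

/-- A new edge contains the new largest vertex `j`, and its other `k - 1` vertices lie among the `h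
- 1` positions before `j`. -/
lemma card_pathEdges_insert_le {k h M : ℕ} (J : Finset (Fin M)) (j : Fin M) (hJ : ∀ i ∈ J, i < j) :
    #{e ∈ pathEdges k h M | e ⊆ insert j J} ≤
      #{e ∈ pathEdges k h M | e ⊆ J} + (h - 1).choose (k - 1) := by
  have h1 : {e ∈ pathEdges k h M | e ⊆ insert j J} ⊆
      {e ∈ pathEdges k h M | e ⊆ J} ∪ {e ∈ pathEdges k h M | e ⊆ insert j J ∧ j ∈ e} := by
    intro e he
    simp only [mem_union, mem_filter] at he ⊢
    by_cases hj : j ∈ e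
    · exact Or.inr ⟨he.1, he.2, hj⟩
    · exact Or.inl ⟨he.1, (subset_insert_iff_of_notMem hj).1 he.2⟩
  refine (card_le_card h1).trans ((card_union_le _ _).trans (Nat.add_le_add_left ?_ _))
  calc _ ≤ #(powersetCard (k - 1) (J.filter fun i : Fin M => (j : ℕ) < i + h)) := by
        refine card_le_card_of_injOn (fun e => e.erase j) ?_ ?_
        · intro e he
          simp only [coe_filter, Set.mem_ofPred_eq, pathEdges, mem_filter, mem_univ, true_and] at he
          obtain ⟨⟨hk, hw⟩, hs, hj⟩ := he
          rw [mem_coe, mem_powersetCard, card_erase_of_mem hj, hk]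
          refine ⟨fun i hi => ?_, rfl⟩
          rw [mem_erase] at hi
          exact mem_filter.2 ⟨mem_of_mem_insert_of_ne (hs hi.2) hi.1, hw i hi.2 j hj⟩
        · intro a ha b hb hab
          simp only [coe_filter, Set.mem_ofPred_eq] at ha hb
          rw [← insert_erase ha.2.2, ← insert_erase hb.2.2]
          exact congrArg (insert j) hab
    _ ≤ (h - 1).choose (k - 1) := by
        rw [card_powersetCard]
        exact Nat.choose_le_choose _ (card_filter_window_le J j hJ)

/-- The density of the subgraphs of an `(r,k)`-path. -/
lemma two_mul_card_pathEdges_le {k h M : ℕ} (hk : 2 ≤ k) (hkh : k ≤ h) (hh : 3 ≤ h)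
    (J : Finset (Fin M)) (hJ : 2 ≤ #J) :
    2 * #{e ∈ pathEdges k h M | e ⊆ J} + 3 * (h - 1).choose (k - 1) ≤
      2 * #J * (h - 1).choose (k - 1) := by
  induction J using Finset.induction_on_max with
  | empty => simp at hJ
  | insert j J hj ih =>
    have hjJ : j ∉ J := fun h => lt_irrefl _ (hj j h)
    rw [card_insert_of_notMem hjJ] at hJ ⊢
    rcases Nat.lt_or_ge (#J) 2 with h2 | h2
    · have h1 : #J = 1 := by omega
      have hle : #{e ∈ pathEdges k h M | e ⊆ insert j J} ≤ Nat.choose 2 k := by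
        rw [← show #(insert j J) = 2 by rw [card_insert_of_notMem hjJ, h1], ← card_powersetCard]
        refine card_le_card fun e he => ?_
        simp only [pathEdges, mem_filter, mem_univ, true_and] at he
        exact mem_powersetCard.2 ⟨he.2, he.1.1⟩
      -- Two vertices span an edge only for `k = 2`, and then `h ≥ 3` is needed. This base case
      -- yields the surplus `3 / 2`; afterwards each vertex adds at most `(h - 1).choose (k - 1)`
      -- edges.
      have hD : 2 * Nat.choose 2 k ≤ (h - 1).choose (k - 1) := by
        rcases Nat.lt_or_ge 2 k with hk2 | hk2
        · simp [Nat.choose_eq_zero_of_lt hk2]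
        · obtain rfl : k = 2 := by omega
          simp
          omega
      rw [h1]
      omega
    · have h3 := ih h2
      have h4 := card_pathEdges_insert_le (k := k) (h := h) J j hj
      have h5 : 2 * (#J + 1) * (h - 1).choose (k - 1) =
        2 * #J * (h - 1).choose (k - 1) + 2 * (h - 1).choose (k - 1) := by ring
      omega

end PathEdges

/-! ### Finding a path copy in the random graph -/

section Copies
variable {n k h M : ℕ}

/-- The edges of the copy of the `(r,k)`-path placed on the vertices `t 0, …, t (M - 1)`. -/
def copyEdges (k h : ℕ) (t : Fin M → Fin n) : Finset (Finset (Fin n)) :=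
  (pathEdges k h M).image fun e => e.image t

lemma card_copyEdges {t : Fin M → Fin n} (ht : t.Injective) :
    #(copyEdges k h t) = #(pathEdges k h M) :=
  card_image_of_injective _ (image_injective ht)

lemma copyEdges_subset {t : Fin M → Fin n} (ht : t.Injective) :
    copyEdges k h t ⊆ univ.filter fun e => #e = k := by
  intro e he
  obtain ⟨e', he', rfl⟩ := mem_image.1 he
  rw [mem_filter, card_image_of_injective _ ht]
  exact ⟨mem_univ _, (mem_filter.1 he').2.1⟩

/-- A common edge has all its vertices in both images, so it pulls back along `t'` to an edge on the
overlap positions. -/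
lemma card_inter_copyEdges_le {t t' : Fin M → Fin n} (ht' : t'.Injective) :
    #(copyEdges k h t ∩ copyEdges k h t') ≤
      #{e ∈ pathEdges k h M | e ⊆ univ.filter fun i => t' i ∈ univ.image t} := by
  rw [← card_image_of_injective _ (image_injective ht')]
  refine card_le_card fun e he => ?_
  rw [mem_inter] at he
  obtain ⟨e₁, _, h₁⟩ := mem_image.1 he.1
  obtain ⟨e₂, he₂, rfl⟩ := mem_image.1 he.2
  refine mem_image.2 ⟨e₂, mem_filter.2 ⟨he₂, fun i hi => mem_filter.2 ⟨mem_univ _, ?_⟩⟩, rfl⟩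
  have : t' i ∈ e₁.image t := h₁ ▸ mem_image_of_mem _ hi
  exact image_subset_image (subset_univ _) this

/-- The sum factors over coordinates: each contributes at most `M` vertices of weight `n` and `n` of
weight `1`. -/
lemma sum_pow_card_overlap_le (t : Fin M → Fin n) :
    ∑ t' : Fin M → Fin n, (n : ℝ) ^ #(univ.filter fun i => t' i ∈ univ.image t) ≤
      (((M : ℝ) + 1) * n) ^ M := by
  have h1 : ∀ t' : Fin M → Fin n, (n : ℝ) ^ #(univ.filter fun i => t' i ∈ univ.image t) =
      ∏ i, if t' i ∈ univ.image t then (n : ℝ) else 1 := by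
    intro t'
    rw [prod_ite, prod_const, prod_const_one, mul_one]
  simp_rw [h1]
  have h2 := Finset.prod_univ_sum (fun _ : Fin M => (univ : Finset (Fin n)))
    (fun _ v => if v ∈ univ.image t then (n : ℝ) else 1)
  rw [Fintype.piFinset_univ] at h2
  rw [← h2, prod_const, card_univ, Fintype.card_fin]
  refine pow_le_pow_left₀ (sum_nonneg fun v _ => by split_ifs <;> positivity) ?_ _
  rw [sum_ite, sum_const, sum_const, nsmul_eq_mul, nsmul_eq_mul, mul_one]
  have h3 : (#(univ.filter fun v => v ∈ univ.image t) : ℝ) ≤ M := by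
    rw [filter_mem_eq_inter, univ_inter]
    exact_mod_cast card_image_le.trans (by simp)
  have h4 : (#(univ.filter fun v => v ∉ univ.image t) : ℝ) ≤ n := by
    exact_mod_cast (card_filter_le _ _).trans (by simp)
  have := mul_le_mul_of_nonneg_right h3 (Nat.cast_nonneg (α := ℝ) n)
  linarith

/-- Sharing edges saves powers of `p` but costs free vertices. By `hdens` the cost wins by `n ^ (5 /
4)`, and the factor `n ^ #J` is kept so that summing over `t'` factorizes. -/
lemma pow_card_union_copyEdges_le {p : ℝ} (hp : 0 < p) (hp1 : p ≤ 1) (hn : 0 < n)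
    (hdens : ∀ J : Finset (Fin M), 0 < #{e ∈ pathEdges k h M | e ⊆ J} →
      (n : ℝ) ^ (5 / 4 : ℝ) ≤ (n : ℝ) ^ #J * p ^ #{e ∈ pathEdges k h M | e ⊆ J})
    {t t' : Fin M → Fin n} (ht : t.Injective) (ht' : t'.Injective)
    (hd : ¬ Disjoint (copyEdges k h t) (copyEdges k h t')) :
    p ^ #(copyEdges k h t ∪ copyEdges k h t') ≤
      p ^ (2 * #(pathEdges k h M)) / (n : ℝ) ^ (5 / 4 : ℝ) *
        (n : ℝ) ^ #(univ.filter fun i => t' i ∈ univ.image t) := by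
  set J := univ.filter fun i => t' i ∈ univ.image t
  set m := #(pathEdges k h M)
  have hle : #(copyEdges k h t ∩ copyEdges k h t') ≤ #{e ∈ pathEdges k h M | e ⊆ J} :=
    card_inter_copyEdges_le ht'
  have hpos : 0 < #(copyEdges k h t ∩ copyEdges k h t') := by
    rw [card_pos, nonempty_iff_ne_empty, Ne, ← disjoint_iff_inter_eq_empty]
    exact hd
  have hJ := hdens J (hpos.trans_le hle)
  have hcard : #(copyEdges k h t ∪ copyEdges k h t') + #(copyEdges k h t ∩ copyEdges k h t') =
      2 * m := by
    rw [card_union_add_card_inter, card_copyEdges ht, card_copyEdges ht']; ring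
  have hn' : (0 : ℝ) < (n : ℝ) ^ (5 / 4 : ℝ) := Real.rpow_pos_of_pos (by exact_mod_cast hn) _
  rw [div_mul_eq_mul_div, le_div_iff₀ hn']
  calc _ ≤ p ^ #(copyEdges k h t ∪ copyEdges k h t') *
        ((n : ℝ) ^ #J * p ^ #(copyEdges k h t ∩ copyEdges k h t')) := by
        refine mul_le_mul_of_nonneg_left (hJ.trans ?_) (pow_pos hp _).le
        exact mul_le_mul_of_nonneg_left (pow_le_pow_of_le_one hp.le hp1 hle) (by positivity)
    _ = _ := by rw [← hcard, pow_add]; ring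

lemma sum_pow_card_union_copyEdges_le {p : ℝ} (hp : 0 < p) (hp1 : p ≤ 1) (hn : 0 < n)
    (hdens : ∀ J : Finset (Fin M), 0 < #{e ∈ pathEdges k h M | e ⊆ J} →
      (n : ℝ) ^ (5 / 4 : ℝ) ≤ (n : ℝ) ^ #J * p ^ #{e ∈ pathEdges k h M | e ⊆ J})
    (F : Finset (Fin M → Fin n)) (hF : ∀ t ∈ F, t.Injective) :
    ∑ t ∈ F, ∑ t' ∈ F with ¬ Disjoint (copyEdges k h t) (copyEdges k h t'),
        p ^ #(copyEdges k h t ∪ copyEdges k h t') ≤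
      #F * (p ^ (2 * #(pathEdges k h M)) / (n : ℝ) ^ (5 / 4 : ℝ) * (((M : ℝ) + 1) * n) ^ M) := by
  generalize hC : p ^ (2 * #(pathEdges k h M)) / (n : ℝ) ^ (5 / 4 : ℝ) = C
  have h0 : 0 ≤ C :=
    hC ▸ div_nonneg (pow_nonneg hp.le _) (Real.rpow_nonneg (Nat.cast_nonneg _) _)
  have h1 : ∀ t ∈ F, ∑ t' ∈ F with ¬ Disjoint (copyEdges k h t) (copyEdges k h t'),
      p ^ #(copyEdges k h t ∪ copyEdges k h t') ≤ C * (((M : ℝ) + 1) * n) ^ M := by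
    intro t ht
    refine le_trans ?_ (mul_le_mul_of_nonneg_left (sum_pow_card_overlap_le t) h0)
    rw [mul_sum]
    refine le_trans (sum_le_sum fun t' ht' => ?_) (sum_le_sum_of_subset_of_nonneg
      (subset_univ _) fun _ _ _ => mul_nonneg h0 (pow_nonneg (Nat.cast_nonneg _) _))
    rw [mem_filter] at ht'
    rw [← hC]
    exact pow_card_union_copyEdges_le hp hp1 hn hdens (hF t ht) (hF t' ht'.1) ht'.2
  calc _ ≤ ∑ _t ∈ F, C * (((M : ℝ) + 1) * n) ^ M := sum_le_sum h1
    _ = _ := by rw [sum_const, nsmul_eq_mul]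

lemma setBernoulli_real_eq_bernoulliExp {β : Type*} [DecidableEq β] [Fintype β] (U : Finset β)
    (p : unitInterval) (Q : Set β → Prop) [DecidablePred Q] :
    (ProbabilityTheory.setBernoulli (U : Set β) p).real {G | Q G} =
      bernoulliExp U p fun S => if Q S then 1 else 0 := by
  rw [MeasureTheory.measureReal_def, ProbabilityTheory.setBernoulli_apply_eq_apply_subsets,
    ← MeasureTheory.measureReal_def]
  have : {s ∈ {G | Q G} | s ⊆ (U : Set β)} =
      ⋃ S ∈ U.powerset.filter fun S : Finset β => Q (S : Set β), {(S : Set β)} := by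
    ext G
    simp only [Set.mem_ofPred_eq, mem_filter, mem_powerset, Set.mem_iUnion, Set.mem_singleton_iff,
      exists_prop]
    constructor
    · rintro ⟨h1, h2⟩
      have : G.Finite := G.toFinite
      exact ⟨this.toFinset, by simpa using ⟨h2, h1⟩, by simp⟩
    · rintro ⟨S, ⟨h1, h2⟩, rfl⟩
      exact ⟨h2, by exact_mod_cast h1⟩
  rw [this, MeasureTheory.measureReal_biUnion_finset]
  · rw [sum_filter, bernoulliExp]
    refine sum_congr rfl fun S hS => ?_
    rw [mem_powerset] at hS
    split_ifs with hQ
    · rw [ProbabilityTheory.setBernoulli_real_singleton p (by exact_mod_cast hS) U.finite_toSet,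
        bernoulliWeight, if_pos hS, ← coe_sdiff, Set.ncard_coe_finset, Set.ncard_coe_finset,
        mul_one]
    · simp
  · intro S _ T _ hST
    simpa using hST
  · intro S _
    exact MeasurableSet.singleton _

/-- A dense family of vertex tuples contains a copy of the `(r,k)`-path in the random graph, with
very high probability. -/
lemma binomialRandom_no_path_le {β : ℝ} {p : unitInterval} (hp : 0 < (p : ℝ)) (hn : 0 < n)
    (hdens : ∀ J : Finset (Fin M), 0 < #{e ∈ pathEdges k h M | e ⊆ J} →
      (n : ℝ) ^ (5 / 4 : ℝ) ≤ (n : ℝ) ^ #J * (p : ℝ) ^ #{e ∈ pathEdges k h M | e ⊆ J})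
    (F : Finset (Fin M → Fin n)) (hF : ∀ t ∈ F, t.Injective) (hβ : β * (n : ℝ) ^ M ≤ #F) :
    (binomialRandom (Fin n) k p).real
        {G | ∀ t ∈ F, ¬ ∀ e ∈ pathEdges k h M, e.image t ∈ G} ≤
      Real.exp (-(β / (2 * ((M : ℝ) + 1) ^ M) * (n : ℝ) ^ (5 / 4 : ℝ))) := by
  classical
  have hn0 : (0 : ℝ) < n := by exact_mod_cast hn
  have hn' : (0 : ℝ) < (n : ℝ) ^ (5 / 4 : ℝ) := Real.rpow_pos_of_pos hn0 _
  have hU : {e : Finset (Fin n) | e.card = k} =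
      ((univ.filter fun e : Finset (Fin n) => #e = k : Finset _) : Set (Finset (Fin n))) := by
    ext; simp
  rw [binomialRandom, hU, setBernoulli_real_eq_bernoulliExp]
  have hiff : ∀ S : Finset (Finset (Fin n)),
      (∀ t ∈ F, ¬ ∀ e ∈ pathEdges k h M, e.image t ∈ (S : Set (Finset (Fin n)))) ↔
      ∀ t ∈ F, ¬ copyEdges k h t ⊆ S := by
    intro S
    refine forall₂_congr fun t _ => not_congr ?_
    rw [copyEdges, image_subset_iff]
    simp
  simp_rw [hiff]
  set m := #(pathEdges k h M)
  -- The minimiser of the exponent once the correlation sum is replaced by its upper bound; `#F`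
  -- cancels from the quotient.
  set s : ℝ := (n : ℝ) ^ (5 / 4 : ℝ) / ((p : ℝ) ^ m * (((M : ℝ) + 1) * n) ^ M) with hs
  have hpm : 0 < (p : ℝ) ^ m := pow_pos hp _
  have hMn : 0 < (((M : ℝ) + 1) * n) ^ M := by positivity
  have hs0 : 0 ≤ s := by positivity
  refine (le_of_eq (by congr!)).trans ((bernoulliExp_no_copy_le (copyEdges k h) F hp p.2.2 hs0
    fun t ht => copyEdges_subset (hF t ht)).trans (Real.exp_le_exp.2 ?_))
  have h1 : ∑ t ∈ F, (p : ℝ) ^ #(copyEdges k h t) = #F * (p : ℝ) ^ m := by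
    rw [sum_congr rfl fun t ht => by rw [card_copyEdges (hF t ht)], sum_const, nsmul_eq_mul]
  have h2 := mul_le_mul_of_nonneg_left
    (sum_pow_card_union_copyEdges_le hp p.2.2 hn hdens F hF) (by positivity : 0 ≤ s ^ 2 / 2)
  rw [h1]
  refine (add_le_add_right h2 _).trans ?_
  have h3 : -(s * (#F * (p : ℝ) ^ m)) + s ^ 2 / 2 *
      (#F * ((p : ℝ) ^ (2 * m) / (n : ℝ) ^ (5 / 4 : ℝ) * (((M : ℝ) + 1) * n) ^ M)) =
      -(#F * ((n : ℝ) ^ (5 / 4 : ℝ) / (2 * (((M : ℝ) + 1) * n) ^ M))) := by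
    rw [hs]
    field_simp
    ring
  rw [h3]
  refine neg_le_neg ?_
  calc _ = β * (n : ℝ) ^ M * ((n : ℝ) ^ (5 / 4 : ℝ) / (2 * (((M : ℝ) + 1) * n) ^ M)) := by
        rw [mul_pow]; field_simp
    _ ≤ _ := mul_le_mul_of_nonneg_right hβ (by positivity)

/-- The density bound reads `c * E ≤ #J - 3 / 2`, giving `n ^ (3 / 2)` at `p = n ^ (-c)`; the loss
from `ε` is at most `n ^ (1 / 4)`. -/
lemma rpow_le_of_density {c ε p : ℝ} (hk : 2 ≤ k) (hkh : k ≤ h) (hh : 3 ≤ h)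
    (hc : c = ((h - 1).choose (k - 1) : ℝ)⁻¹) (hε : 0 ≤ ε)
    (hεM : ε * (h - 1).choose (k - 1) * M ≤ 1 / 4) (hn : 0 < n) (hp : (n : ℝ) ^ (-c - ε) ≤ p)
    (J : Finset (Fin M)) (hJ : 0 < #{e ∈ pathEdges k h M | e ⊆ J}) :
    (n : ℝ) ^ (5 / 4 : ℝ) ≤ (n : ℝ) ^ #J * p ^ #{e ∈ pathEdges k h M | e ⊆ J} := by
  have hn1 : (1 : ℝ) ≤ n := by exact_mod_cast hn
  have hn0 : (0 : ℝ) < n := by linarith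
  set D := (h - 1).choose (k - 1) with hD
  have hD0 : (0 : ℝ) < D := by
    exact_mod_cast Nat.choose_pos (by omega)
  set E := #{e ∈ pathEdges k h M | e ⊆ J} with hE
  have hJ2 : 2 ≤ #J := by
    obtain ⟨e, he⟩ := card_pos.1 hJ
    simp only [pathEdges, mem_filter, mem_univ, true_and] at he
    exact hk.trans (he.1.1 ▸ card_le_card he.2)
  have h1 : 2 * (E : ℝ) + 3 * D ≤ 2 * #J * D := by
    exact_mod_cast two_mul_card_pathEdges_le hk hkh hh J hJ2
  have hJM : (#J : ℝ) ≤ M := by exact_mod_cast (card_le_univ J).trans (by simp)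
  have hcD : c * D = 1 := by rw [hc]; field_simp
  have hc0 : 0 < c := by rw [hc]; positivity
  calc (n : ℝ) ^ (5 / 4 : ℝ) ≤ (n : ℝ) ^ ((#J : ℝ) + (-c - ε) * E) := by
        refine Real.rpow_le_rpow_of_exponent_le hn1 ?_
        have h2 : (E : ℝ) ≤ (#J - 3 / 2) * D := by linarith
        have h3 : c * E ≤ #J - 3 / 2 := by
          calc c * E ≤ c * ((#J - 3 / 2) * D) := mul_le_mul_of_nonneg_left h2 hc0.le
            _ = (#J - 3 / 2) * (c * D) := by ring
            _ = _ := by rw [hcD, mul_one]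
        have h4 : ε * E ≤ 1 / 4 := by
          refine le_trans ?_ hεM
          rw [mul_assoc]
          refine mul_le_mul_of_nonneg_left ?_ hε
          nlinarith
        linarith
    _ = (n : ℝ) ^ #J * ((n : ℝ) ^ (-c - ε)) ^ E := by
        rw [Real.rpow_add hn0, Real.rpow_natCast, Real.rpow_mul hn0.le, Real.rpow_natCast]
    _ ≤ _ := by
        refine mul_le_mul_of_nonneg_left ?_ (by positivity)
        exact pow_le_pow_left₀ (by positivity) hp _

end Copies

/-! ### Lists grown at the front, and blocks that absorb a vertex -/

section Chain
variable {V : Type*}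

/-- `R x l` holds for every nonempty suffix `x :: l` of the list. -/
def SuffixChain (R : V → List V → Prop) : List V → Prop
  | [] => True
  | x :: l => R x l ∧ SuffixChain R l

lemma SuffixChain.append {R R' : V → List V → Prop} {B Q : List V} (hB : SuffixChain R' B)
    (hstep : ∀ x l, x :: l <:+ B → R' x l → R x (l ++ Q)) (hQ : SuffixChain R Q) :
    SuffixChain R (B ++ Q) := by
  induction B with
  | nil => exact hQ
  | cons x l ih =>
    exact ⟨hstep x l List.suffix_rfl hB.1,
      ih hB.2 fun y l' h => hstep y l' (h.trans (List.suffix_cons _ _))⟩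

lemma SuffixChain.of_suffix {R : V → List V → Prop} {B B' : List V} (hB : SuffixChain R B)
    (h : B' <:+ B) : SuffixChain R B' := by
  induction B with
  | nil => rw [List.suffix_nil.1 h]; trivial
  | cons x l ih =>
    rcases List.suffix_cons_iff.1 h with rfl | h'
    · exact hB
    · exact ih hB.2 h'

lemma SuffixChain.of_cons_suffix {R : V → List V → Prop} {B l : List V} {x : V}
    (hB : SuffixChain R B) (h : x :: l <:+ B) : R x l := (hB.of_suffix h).1

lemma SuffixChain.and {R R' : V → List V → Prop} {B : List V} (hB : SuffixChain R B)
    (hB' : SuffixChain R' B) : SuffixChain (fun x l => R x l ∧ R' x l) B := by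
  induction B with
  | nil => trivial
  | cons x l ih => exact ⟨⟨hB.1, hB'.1⟩, ih hB.2 hB'.2⟩

lemma SuffixChain.of_getElem {R : V → List V → Prop} {B : List V}
    (h : ∀ (i : ℕ) (hi : i < B.length), R B[i] (B.drop (i + 1))) : SuffixChain R B := by
  induction B with
  | nil => trivial
  | cons x l ih =>
    exact ⟨h 0 (Nat.succ_pos _), ih fun i hi => h (i + 1) (Nat.succ_lt_succ hi)⟩

variable [DecidableEq V]

/-- Adding `x` in front of `l` creates only edges of `E`: all sets consisting of `x` and `j` of the
first `m` vertices of `l` belong to `E`. -/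
def Extends (E : Set (Finset V)) (j m : ℕ) (x : V) (l : List V) : Prop :=
  ∀ S ⊆ (l.take m).toFinset, #S = j → insert x S ∈ E

/-- The link of `v`. -/
def link (H : Set (Finset V)) (v : V) : Set (Finset V) := {e | insert v e ∈ H}

/-- Every edge is checked once, when its frontmost vertex is added. -/
lemma mem_of_suffixChain_extends {E : Set (Finset V)} {k h : ℕ} (hk : 1 ≤ k) {P : List V}
    (hP : SuffixChain (Extends E (k - 1) (h - 1)) P) {W : List V} (hW : W <:+: P)
    (hWh : W.length ≤ h) {e : Finset V} (he : #e = k) (heW : ∀ v ∈ e, v ∈ W) : e ∈ E := by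
  induction P generalizing W with
  | nil =>
    rw [List.infix_nil.1 hW] at heW
    have : e = ∅ := eq_empty_of_forall_notMem fun v hv => by simpa using heW v hv
    simp [this] at he
    omega
  | cons x P ih =>
    rcases List.infix_cons_iff.1 hW with hpre | hinf
    · rcases W with - | ⟨y, W⟩
      · exact ih hP.2 (List.nil_infix) hWh heW
      · obtain ⟨rfl, hpre'⟩ := List.cons_prefix_cons.1 hpre
        by_cases hye : y ∈ e
        · rw [← insert_erase hye]
          refine hP.1 _ (fun v hv => ?_) (by rw [card_erase_of_mem hye, he])
          rw [mem_erase] at hv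
          have hvW : v ∈ W := (List.mem_cons.1 (heW v hv.2)).resolve_left hv.1
          have : W <+: P.take (h - 1) := by
            rw [List.prefix_take_iff]
            simp only [List.length_cons] at hWh
            exact ⟨hpre', by omega⟩
          exact List.mem_toFinset.2 (this.subset hvW)
        · refine ih hP.2 hpre'.isInfix (by simp at hWh; omega) fun v hv => ?_
          exact (List.mem_cons.1 (heW v hv)).resolve_left fun h => hye (h ▸ hv)
    · exact ih hP.2 hinf hWh heW

lemma isPath_of_suffixChain {E : Set (Finset V)} {k r : ℕ} (hk : 1 ≤ k) {P : List V}
    (hlen : k + r - 1 ≤ P.length) (hnd : P.Nodup)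
    (hP : SuffixChain (Extends E (k - 1) (k + r - 1 - 1)) P) : IsPath r k E P :=
  ⟨hlen, hnd, fun _ hW hWl _ he heW => mem_of_suffixChain_extends hk hP hW hWl.le he heW⟩

/-- The condition under which `x` may be put in front of the part `l` of a block that is to precede
the path `P` and to absorb `v`. The last `h` vertices of the block continue `P`, the remaining ones
form a path in the link of `v`. -/
def BlockStep (H : Set (Finset V)) (k h : ℕ) (P : List V) (v x : V) (l : List V) : Prop :=
  x ∉ l ∧ x ∉ P ∧ x ≠ v ∧ (l.length < h → Extends H (k - 1) (h - 1) x (l ++ P)) ∧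
    (h ≤ l.length → Extends (link H v) (k - 2) (h - 2) x l)

variable {H G : Set (Finset V)} {k h : ℕ} {P Q B : List V} {v : V}

lemma nodup_of_blockStep (hB : SuffixChain (BlockStep H k h P v) B) : B.Nodup := by
  induction B with
  | nil => simp
  | cons x l ih => exact List.nodup_cons.2 ⟨hB.1.1, ih hB.2⟩

lemma notMem_of_blockStep (hB : SuffixChain (BlockStep H k h P v) B) :
    v ∉ B ∧ ∀ x ∈ B, x ∉ P := by
  induction B with
  | nil => simp
  | cons x l ih =>
    have := ih hB.2
    simp only [List.mem_cons, not_or, forall_eq_or_imp]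
    exact ⟨⟨hB.1.2.2.1.symm, this.1⟩, hB.1.2.1, this.2⟩

/-- Block vertices see only the first `h` vertices of what follows, so `P` may be replaced by any
`Q` with the same beginning, in particular by `P` with vertices already absorbed. -/
lemma suffixChain_append_of_blockStep (hB : SuffixChain (BlockStep H k h P v) B)
    (hG : SuffixChain (Extends G (k - 1) (h - 1)) B) (hPQ : P.take h = Q.take h)
    (hQ : SuffixChain (Extends (H ∪ G) (k - 1) (h - 1)) Q) :
    SuffixChain (Extends (H ∪ G) (k - 1) (h - 1)) (B ++ Q) := by
  refine (hB.and hG).append (fun x l _ hx => ?_) hQ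
  rcases Nat.lt_or_ge l.length h with hl | hl
  · intro S hS hc
    refine Or.inl (hx.1.2.2.2.1 hl S (hS.trans (le_of_eq ?_)) hc)
    have : P.take (h - 1 - l.length) = Q.take (h - 1 - l.length) := by
      have := congrArg (List.take (h - 1 - l.length)) hPQ
      rwa [List.take_take, List.take_take, min_eq_left (by omega)] at this
    rw [List.take_append, List.take_append, this]
  · intro S hS hc
    refine Or.inr (hx.2 S (hS.trans (le_of_eq ?_)) hc)
    rw [List.take_append_of_le_length (by omega)]

/-- Since `h + m ≤ B.length`, the first `m` vertices belong to the link part; the link condition is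
applied at the frontmost vertex of `S`. -/
lemma insert_mem_of_blockStep (hk : 2 ≤ k) {m : ℕ} (hm : m ≤ h - 1)
    (hB : SuffixChain (BlockStep H k h P v) B) (hlen : h + m ≤ B.length) {S : Finset V}
    (hS : S ⊆ (B.take m).toFinset) (hc : #S = k - 1) : insert v S ∈ H := by
  induction m generalizing B with
  | zero =>
    have : S = ∅ := by simpa using hS
    have : k - 1 = 0 := by simpa [this] using hc.symm
    omega
  | succ m ih =>
    rcases B with - | ⟨x, l⟩
    · simp only [List.length_nil] at hlen
      omega
    · simp only [List.length_cons] at hlen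
      rw [List.take_succ_cons, List.toFinset_cons] at hS
      by_cases hx : x ∈ S
      · have := hB.1.2.2.2.2 (by omega) (S.erase x) (fun y hy => ?_)
          (by rw [card_erase_of_mem hx, hc]; omega)
        · rwa [insert_erase hx] at this
        · rw [mem_erase] at hy
          have hy' := List.mem_toFinset.1 (mem_of_mem_insert_of_ne (hS hy.2) hy.1)
          exact List.mem_toFinset.2 (((List.take_prefix_take_left (by omega)).subset) hy')
      · exact ih (by omega) hB.2 (by omega) ((subset_insert_iff_of_notMem hx).1 hS)

/-- The three thirds of the block have separate roles: `h` vertices in front of `v`, `h` behind it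
still in its link, and `h` that continue `P` in `H`. -/
lemma suffixChain_insert_of_blockStep (hk : 2 ≤ k) (hh : 2 ≤ h) (hlen : B.length = 3 * h)
    (hB : SuffixChain (BlockStep H k h P v) B)
    (hG : SuffixChain (Extends G (k - 1) (h - 1)) B) (hPQ : P.take h = Q.take h)
    (hQ : SuffixChain (Extends (H ∪ G) (k - 1) (h - 1)) Q) :
    SuffixChain (Extends (H ∪ G) (k - 1) (h - 1)) (B.take h ++ v :: (B.drop h ++ Q)) := by
  set B₁ := B.take h with hB₁
  set B₂ := B.drop h with hB₂
  have hl₂ : B₂.length = 2 * h := by rw [hB₂, List.length_drop]; omega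
  have hsuf : B₂ <:+ B := List.drop_suffix _ _
  have hstep : ∀ x l, x :: l <:+ B₁ → BlockStep H k h P v x (l ++ B₂) ∧
      Extends G (k - 1) (h - 1) x (l ++ B₂) := by
    intro x l hxl
    have : x :: (l ++ B₂) <:+ B := by
      rw [← List.take_append_drop h B, ← List.cons_append]
      obtain ⟨t, ht⟩ := hxl
      exact ⟨t, by rw [← List.append_assoc, ht]⟩
    exact ⟨hB.of_cons_suffix this, hG.of_cons_suffix this⟩
  have htriv : SuffixChain (fun _ _ => True) B₁ := SuffixChain.of_getElem fun _ _ => trivial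
  refine htriv.append (fun x l hxl _ => ?_)
    ⟨?_, suffixChain_append_of_blockStep (hB.of_suffix hsuf) (hG.of_suffix hsuf) hPQ hQ⟩
  · obtain ⟨hx, hxG⟩ := hstep x l hxl
    have hlink := hx.2.2.2.2 (by rw [List.length_append]; omega)
    intro S hS hc
    -- Edges through `v` use the link, where `v` takes one place and `h - 2` vertices remain.
    -- Without `v`, the set already lay in a window of the original block, hence in `G`.
    by_cases hv : v ∈ S
    · have hsub : S.erase v ⊆ ((l ++ B₂).take (h - 2)).toFinset := by
        intro y hy
        rw [mem_erase] at hy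
        have hy' := List.mem_toFinset.1 (hS hy.2)
        rw [List.take_append, List.mem_append] at hy'
        rw [List.mem_toFinset, List.take_append, List.mem_append]
        rcases Nat.lt_or_ge l.length (h - 1) with hl | hl
        · rcases hy' with hy' | hy'
          · left
            rw [List.take_of_length_le (by omega)]
            exact List.mem_of_mem_take hy'
          · right
            obtain ⟨j, hj⟩ : ∃ j, h - 1 - l.length = j + 1 := ⟨h - 2 - l.length, by omega⟩
            rw [hj, List.take_succ_cons, List.mem_cons] at hy'
            have := hy'.resolve_left hy.1
            rw [List.take_append_of_le_length (by omega)] at this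
            rwa [show h - 2 - l.length = j by omega]
        · exfalso
          have hvl : v ∈ l := by
            have hv' := List.mem_toFinset.1 (hS hv)
            rw [List.take_append, List.mem_append, show h - 1 - l.length = 0 by omega] at hv'
            simpa using hv'.imp_left List.mem_of_mem_take
          have : v ∈ B := by
            rw [← List.take_append_drop h B]
            exact List.mem_append_left _ (hxl.subset (List.mem_cons_of_mem _ hvl))
          exact (notMem_of_blockStep hB).1 this
      have := hlink _ hsub (by rw [card_erase_of_mem hv, hc]; omega)
      left
      change insert v (insert x (S.erase v)) ∈ H at this
      rwa [insert_comm, insert_erase hv] at this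
    · right
      refine hxG S (fun y hy => ?_) hc
      have hy' := List.mem_toFinset.1 (hS hy)
      rw [List.take_append, List.mem_append] at hy'
      rw [List.mem_toFinset, List.take_append, List.mem_append]
      refine hy'.imp_right fun hy' => ?_
      rcases hj : h - 1 - l.length with - | j
      · simp [hj] at hy'
      · rw [hj, List.take_succ_cons, List.mem_cons] at hy'
        have := hy'.resolve_left fun h => hv (h ▸ hy)
        rw [List.take_append_of_le_length (by omega)] at this
        exact (List.take_prefix_take_left (by omega)).subset this
  · intro S hS hc
    left
    rw [List.take_append_of_le_length (by omega)] at hS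
    exact insert_mem_of_blockStep hk le_rfl (hB.of_suffix hsuf) (by omega) hS hc

end Chain

/-! ### Concatenating blocks and absorbing a set -/

section Blocks
variable {V : Type*} {h : ℕ} {o : ℕ → List V}

/-- The concatenation of the blocks of `L`, with `o i` inserted after the first `h` vertices of the
block at position `i`. -/
def insertBlocks (h : ℕ) (o : ℕ → List V) : List (List V) → List V
  | [] => []
  | B :: L => B.take h ++ (o L.length ++ (B.drop h ++ insertBlocks h o L))

lemma insertBlocks_nil (L : List (List V)) : insertBlocks h (fun _ => []) L = L.flatten := by
  induction L with
  | nil => rfl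
  | cons B L ih =>
    rw [insertBlocks, ih, List.nil_append, ← List.append_assoc, List.take_append_drop,
      List.flatten_cons]

lemma rtake_eq_of_common_suffix {T X Y : List V} (hT : h ≤ T.length) (hX : T <:+ X)
    (hY : T <:+ Y) : X.rtake h = Y.rtake h := by
  obtain ⟨A, rfl⟩ := hX
  obtain ⟨A', rfl⟩ := hY
  rw [List.rtake_eq_reverse_take_reverse, List.rtake_eq_reverse_take_reverse,
    List.reverse_append, List.reverse_append, List.take_append_of_le_length (by simpa),
    List.take_append_of_le_length (by simpa)]

end Blocks

section Absorb
variable {V : Type*} [DecidableEq V]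

/-- The blocks of `L` can be put one in front of the other, starting with the last one of `L`, and
each of them absorbs some vertex. -/
def ValidBlocks (H G : Set (Finset V)) (k h : ℕ) : List (List V) → Prop
  | [] => True
  | B :: L => (B.length = 3 * h ∧ SuffixChain (Extends G (k - 1) (h - 1)) B ∧
      ∃ v, SuffixChain (BlockStep H k h L.flatten v) B) ∧ ValidBlocks H G k h L

open Classical in
/-- The positions (counted from the end) of the blocks of `L` that absorb `v`. -/
noncomputable def absorbers (H : Set (Finset V)) (k h : ℕ) (v : V) : List (List V) → Finset ℕ
  | [] => ∅
  | B :: L => if SuffixChain (BlockStep H k h L.flatten v) B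
      then insert L.length (absorbers H k h v L) else absorbers H k h v L

variable {H G : Set (Finset V)} {k h : ℕ} {v : V} {o : ℕ → List V}

lemma lt_of_mem_absorbers {L : List (List V)} {i : ℕ} (hi : i ∈ absorbers H k h v L) :
    i < L.length := by
  induction L with
  | nil => simp [absorbers] at hi
  | cons B L ih =>
    rw [absorbers] at hi
    rw [List.length_cons]
    split_ifs at hi
    · rcases mem_insert.1 hi with rfl | hi
      · omega
      · have := ih hi
        omega
    · have := ih hi
      omega

lemma card_absorbers_cons_of_suffixChain {L : List (List V)} {B : List V}
    (hB : SuffixChain (BlockStep H k h L.flatten v) B) :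
    #(absorbers H k h v (B :: L)) = #(absorbers H k h v L) + 1 := by
  rw [absorbers, if_pos hB, card_insert_of_notMem]
  exact fun h => lt_irrefl _ (lt_of_mem_absorbers h)

lemma card_absorbers_cons_of_not_suffixChain {L : List (List V)} {B : List V}
    (hB : ¬ SuffixChain (BlockStep H k h L.flatten v) B) :
    #(absorbers H k h v (B :: L)) = #(absorbers H k h v L) := by
  rw [absorbers, if_neg hB]

lemma insertBlocks_perm (L : List (List V)) :
    (insertBlocks h o L).Perm (L.flatten ++ (List.range L.length).flatMap o) := by
  induction L with
  | nil => simp [insertBlocks]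
  | cons B L ih =>
    rw [insertBlocks, List.length_cons, List.range_succ, List.flatMap_append, List.flatten_cons]
    simp only [List.flatMap_cons, List.flatMap_nil, List.append_nil]
    rw [List.perm_iff_count] at ih ⊢
    intro a
    have h1 := ih a
    have h2 := congrArg (List.count a) (List.take_append_drop h B)
    simp only [List.count_append] at h1 h2 ⊢
    omega

/-- Insertion happens only after the first `h` vertices of a block. Besides fixing the front end,
this lets the next block still fit. -/
lemma insertBlocks_take {L : List (List V)} (hL : ValidBlocks H G k h L) :
    L.flatten.take h = (insertBlocks h o L).take h := by
  cases L with
  | nil => rfl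
  | cons B L =>
    have hlen := hL.1.1
    have hB : (B.take h).length = h := by rw [List.length_take]; omega
    rw [insertBlocks, List.flatten_cons, List.take_append_of_le_length (by omega),
      List.take_append_of_le_length (by omega), List.take_take, min_self]

lemma suffixChain_insertBlocks (hk : 2 ≤ k) (hh : 2 ≤ h) {L : List (List V)}
    (hL : ValidBlocks H G k h L)
    (ho : ∀ i, o i = [] ∨ ∃ v, o i = [v] ∧ i ∈ absorbers H k h v L) :
    SuffixChain (Extends (H ∪ G) (k - 1) (h - 1)) (insertBlocks h o L) := by
  -- Positions count from the end, so prepending a block does not renumber the others; the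
  -- restriction to `i < L.length` makes the hypothesis pass to the tail.
  replace ho : ∀ i < L.length, o i = [] ∨ ∃ v, o i = [v] ∧ i ∈ absorbers H k h v L :=
    fun i _ => ho i
  induction L with
  | nil => trivial
  | cons B L ih =>
    obtain ⟨⟨hlen, hG, v, hv⟩, hL'⟩ := hL
    have htake : L.flatten.take h = (insertBlocks h o L).take h := insertBlocks_take hL'
    have hQ := ih hL' fun i hi => by
      refine (ho i (by rw [List.length_cons]; omega)).imp_right ?_
      rintro ⟨v, h1, h2⟩
      refine ⟨v, h1, ?_⟩
      rw [absorbers] at h2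
      split_ifs at h2
      · exact (mem_insert.1 h2).resolve_left hi.ne
      · exact h2
    rw [insertBlocks]
    rcases ho L.length (by simp) with h0 | ⟨w, h1, h2⟩
    · rw [h0, List.nil_append, ← List.append_assoc, List.take_append_drop]
      exact suffixChain_append_of_blockStep hv hG htake hQ
    · rw [h1]
      have hw : SuffixChain (BlockStep H k h L.flatten w) B := by
        by_contra hcon
        rw [absorbers, if_neg hcon] at h2
        exact lt_irrefl _ (lt_of_mem_absorbers h2)
      exact suffixChain_insert_of_blockStep hk hh hlen hw hG htake hQ

lemma nodup_flatten_of_validBlocks {L : List (List V)} (hL : ValidBlocks H G k h L) :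
    L.flatten.Nodup := by
  induction L with
  | nil => simp
  | cons B L ih =>
    obtain ⟨⟨-, -, v, hv⟩, hL'⟩ := hL
    rw [List.flatten_cons, List.nodup_append']
    exact ⟨nodup_of_blockStep hv, ih hL', fun x hx => (notMem_of_blockStep hv).2 x hx⟩

/-- The last block keeps its final `2 * h` vertices untouched, which fixes the back end. -/
lemma exists_common_suffix {L : List (List V)} (hL : ValidBlocks H G k h L) (hne : L ≠ []) :
    ∃ T : List V, h ≤ T.length ∧ T <:+ L.flatten ∧ T <:+ insertBlocks h o L := by
  induction L with
  | nil => exact absurd rfl hne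
  | cons B L ih =>
    rw [List.flatten_cons, insertBlocks]
    by_cases h0 : L = []
    · subst h0
      refine ⟨B.drop h, ?_, ?_, ?_⟩
      · rw [List.length_drop, hL.1.1]; omega
      · simpa using List.drop_suffix h B
      · simp only [insertBlocks, List.append_nil]
        exact (List.suffix_append _ _).trans (List.suffix_append _ _)
    · obtain ⟨T, h1, h2, h3⟩ := ih hL.2 h0
      refine ⟨T, h1, h2.trans (List.suffix_append _ _), h3.trans ?_⟩
      exact (List.suffix_append _ _).trans
        ((List.suffix_append _ _).trans (List.suffix_append _ _))

lemma isPath_insertBlocks {r : ℕ} (hk : 2 ≤ k) (hh : 2 ≤ h) (hkr : h = k + r - 1)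
    {L : List (List V)} (hL : ValidBlocks H G k h L) (hne : L ≠ [])
    (ho : ∀ i, o i = [] ∨ ∃ v, o i = [v] ∧ i ∈ absorbers H k h v L)
    (hnd : (insertBlocks h o L).Nodup) : IsPath r k (H ∪ G) (insertBlocks h o L) := by
  obtain ⟨T, hT, -, hT'⟩ := exists_common_suffix (o := o) hL hne
  subst hkr
  exact isPath_of_suffixChain (by omega) (hT.trans hT'.length_le) hnd
    (suffixChain_insertBlocks hk hh hL ho)

/-- A concatenation of blocks in which every vertex has at least `s` absorbers is an absorbing
path. -/
theorem isAbsorbingPath_of_validBlocks {r : ℕ} (hk : 2 ≤ k) (hh : 2 ≤ h) (hkr : h = k + r - 1)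
    {L : List (List V)} (hL : ValidBlocks H G k h L) (hne : L ≠ []) {s : ℝ}
    (hs : ∀ v, s ≤ #(absorbers H k h v L)) : IsAbsorbingPath r k (H ∪ G) s L.flatten := by
  have hnd := nodup_flatten_of_validBlocks hL
  refine ⟨?_, fun X hX hXs => ?_⟩
  · have := isPath_insertBlocks (o := fun _ => []) hk hh hkr hL hne (fun i => Or.inl rfl)
      (by rwa [insertBlocks_nil])
    rwa [insertBlocks_nil] at this
  -- Hall's condition is immediate: a single vertex already has at least `#X` absorbers.
  · obtain ⟨f, hf, hfm⟩ := (Finset.all_card_le_biUnion_card_iff_exists_injective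
      (fun x : X => absorbers H k h (x : V) L)).1 fun A => by
        rcases A.eq_empty_or_nonempty with rfl | ⟨a, ha⟩
        · simp
        · have h1 : (#A : ℝ) ≤ #X := by
            exact_mod_cast (card_le_univ A).trans (by simp)
          have h2 := hs (a : V)
          have h3 : #(absorbers H k h (a : V) L) ≤
              #(A.biUnion fun x : X => absorbers H k h (x : V) L) :=
            card_le_card (subset_biUnion_of_mem (fun x : X => absorbers H k h (x : V) L) ha)
          have h4 : (#A : ℝ) ≤ #(absorbers H k h (a : V) L) := h1.trans (hXs.trans h2)
          exact (Nat.cast_le.1 h4).trans h3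
    classical
    let o : ℕ → List V := fun i => if hi : ∃ x, f x = i then [(hi.choose : V)] else []
    have hof : ∀ x, o (f x) = [(x : V)] := by
      intro x
      have hx : ∃ y, f y = f x := ⟨x, rfl⟩
      simp only [o, dif_pos hx]
      rw [hf hx.choose_spec]
    have hmem : ∀ i y, y ∈ o i ↔ ∃ x, f x = i ∧ (x : V) = y := by
      intro i y
      constructor
      · intro hy
        by_cases hi : ∃ x, f x = i
        · refine ⟨hi.choose, hi.choose_spec, ?_⟩
          simp only [o, dif_pos hi, List.mem_singleton] at hy
          exact hy.symm
        · simp only [o, dif_neg hi, List.not_mem_nil] at hy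
      · rintro ⟨x, rfl, rfl⟩
        simp [hof]
    have ho : ∀ i, o i = [] ∨ ∃ v, o i = [v] ∧ i ∈ absorbers H k h v L := by
      intro i
      by_cases hi : ∃ x, f x = i
      · obtain ⟨x, rfl⟩ := hi
        exact Or.inr ⟨x, hof x, hfm x⟩
      · exact Or.inl (by simp only [o, dif_neg hi])
    have hmem' : ∀ y, y ∈ (List.range L.length).flatMap o ↔ y ∈ X := by
      intro y
      simp only [List.mem_flatMap, List.mem_range, hmem]
      constructor
      · rintro ⟨i, -, x, -, rfl⟩
        exact x.2
      · intro hy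
        exact ⟨f ⟨y, hy⟩, lt_of_mem_absorbers (hfm _), ⟨y, hy⟩, rfl, rfl⟩
    have hndX : ((List.range L.length).flatMap o).Nodup := by
      rw [List.nodup_flatMap]
      refine ⟨fun i _ => ?_, List.nodup_range.imp fun {i j} hij => ?_⟩
      · rcases ho i with h0 | ⟨w, h0, -⟩ <;> simp [h0]
      · intro y hy hy'
        obtain ⟨x, rfl, rfl⟩ := (hmem _ _).1 hy
        obtain ⟨x', rfl, hx'⟩ := (hmem _ _).1 hy'
        exact hij (by rw [Subtype.ext hx'])
    have hperm := insertBlocks_perm (h := h) (o := o) L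
    refine ⟨insertBlocks h o L, isPath_insertBlocks hk hh hkr hL hne ho ?_, ?_, ?_, ?_⟩
    · rw [hperm.nodup_iff, List.nodup_append']
      refine ⟨hnd, hndX, fun y hy hy' => ?_⟩
      exact disjoint_left.1 hX ((hmem' y).1 hy') (List.mem_toFinset.2 hy)
    · ext y
      rw [List.mem_toFinset, hperm.mem_iff, List.mem_append, hmem', mem_union, List.mem_toFinset]
    · rw [← hkr]
      exact insertBlocks_take hL
    · rw [← hkr]
      obtain ⟨T, hT, h1, h2⟩ := exists_common_suffix (o := o) hL hne
      exact rtake_eq_of_common_suffix hT h1 h2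

end Absorb

/-! ### Counting candidate blocks in `H` -/

section Greedy

open Classical in
lemma pow_le_card_suffixChain {V : Type*} [Fintype V] {R : V → List V → Prop} {d : ℝ}
    (hd : 0 ≤ d) (m : ℕ)
    (hR : ∀ l : List V, l.length < m → SuffixChain R l → d ≤ #{x | R x l}) :
    d ^ m ≤ #{b : Fin m → V | SuffixChain R (List.ofFn b)} := by
  induction m with
  | zero => simp [SuffixChain]
  | succ m ih =>
    have ih' := ih fun l hl => hR l (by omega)
    have hcard : #{b : Fin (m + 1) → V | SuffixChain R (List.ofFn b)} =
        ∑ b : Fin m → V with SuffixChain R (List.ofFn b), #{x | R x (List.ofFn b)} := by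
      rw [← card_sigma]
      refine card_bij' (fun b _ => ⟨Fin.tail b, b 0⟩) (fun s _ => Fin.cons s.2 s.1) ?_ ?_ ?_ ?_
      · intro b hb
        simp only [mem_filter, mem_univ, true_and, List.ofFn_succ, SuffixChain] at hb
        simp only [mem_sigma, mem_filter, mem_univ, true_and]
        exact ⟨hb.2, hb.1⟩
      · rintro ⟨b, x⟩ hb
        simp only [mem_sigma, mem_filter, mem_univ, true_and] at hb
        simp only [mem_filter, mem_univ, true_and, List.ofFn_succ, SuffixChain, Fin.cons_zero,
          Fin.cons_succ]
        exact ⟨hb.2, hb.1⟩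
      · intro b _
        simp
      · rintro ⟨b, x⟩ _
        simp
    rw [hcard, pow_succ]
    push_cast
    calc d ^ m * d ≤ #{b : Fin m → V | SuffixChain R (List.ofFn b)} * d :=
          mul_le_mul_of_nonneg_right ih' hd
      _ = #{b : Fin m → V | SuffixChain R (List.ofFn b)} • d := (nsmul_eq_mul _ _).symm
      _ ≤ _ := card_nsmul_le_sum _ _ _ fun b hb => by
          rw [mem_filter] at hb
          exact hR _ (by simp) hb.2

end Greedy

section Degree
variable {n k : ℕ} {H : Set (Finset (Fin n))}

open Classical in
lemma minCodegree_le_card (hk : 1 ≤ k) {S : Finset (Fin n)} (hS : #S = k - 1) :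
    minCodegree k H ≤ #{x | insert x S ∈ H} := by
  refine (Nat.sInf_le ⟨S, hS, rfl⟩ : minDegree k (k - 1) H ≤ degree k H S).trans ?_
  rw [degree, hS, show k - (k - 1) = 1 by omega]
  have : {T : Finset (Fin n) | #T = 1 ∧ S ∪ T ∈ H} ⊆
      ((univ.filter fun x => insert x S ∈ H).image fun x => ({x} : Finset (Fin n)) :
        Finset (Finset (Fin n))) := by
    rintro T ⟨h1, h2⟩
    obtain ⟨x, rfl⟩ := card_eq_one.1 h1
    rw [mem_coe, mem_image]
    exact ⟨x, mem_filter.2 ⟨mem_univ _, by rwa [insert_eq, union_comm]⟩, rfl⟩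
  refine (Set.ncard_le_ncard this (finite_toSet _)).trans ?_
  rw [Set.ncard_coe_finset]
  exact card_image_le

-- Each of at most `D` sets excludes at most `(c - α) * n` vertices. As `c * D = 1`, at most `(1 -
-- α) * n` vertices are lost, besides `Z`.
open Classical in
lemma card_common_neighbors_ge {c α : ℝ} {D : ℕ} (hk : 1 ≤ k) (hD : 1 ≤ D)
    (hc : c = (D : ℝ)⁻¹) (hα : 0 ≤ α) (hdeg : (1 - c + α) * (n : ℝ) ≤ minCodegree k H)
    (A : Finset (Finset (Fin n))) (hA : ∀ S ∈ A, #S = k - 1) (hAD : #A ≤ D) (Z : Finset (Fin n)) :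
    α * n - #Z ≤ #{x | x ∉ Z ∧ ∀ S ∈ A, insert x S ∈ H} := by
  have hD0 : (1 : ℝ) ≤ D := by exact_mod_cast hD
  have hcompl : ∀ S ∈ A, (#{x | insert x S ∉ H} : ℝ) ≤ (c - α) * n := by
    intro S hS
    have h1 : (minCodegree k H : ℝ) ≤ #{x | insert x S ∈ H} := by
      exact_mod_cast minCodegree_le_card hk (hA S hS)
    have h2 := card_filter_add_card_filter_not (s := (univ : Finset (Fin n)))
      (fun x => insert x S ∈ H)
    rw [card_univ, Fintype.card_fin] at h2
    have h3 : (#{x | insert x S ∈ H} : ℝ) + #{x | insert x S ∉ H} = n := by exact_mod_cast h2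
    linarith
  have hcover : (univ : Finset (Fin n)) ⊆ univ.filter (fun x => x ∉ Z ∧ ∀ S ∈ A, insert x S ∈ H) ∪
      (Z ∪ A.biUnion fun S => {x | insert x S ∉ H}) := by
    intro x _
    simp only [mem_union, mem_filter, mem_univ, true_and, mem_biUnion]
    by_cases hx : x ∈ Z
    · exact Or.inr (Or.inl hx)
    · by_cases h : ∀ S ∈ A, insert x S ∈ H
      · exact Or.inl ⟨hx, h⟩
      · push Not at h
        exact Or.inr (Or.inr h)
  have h1 : n ≤ #{x | x ∉ Z ∧ ∀ S ∈ A, insert x S ∈ H} +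
      (#Z + ∑ S ∈ A, #{x | insert x S ∉ H}) := by
    calc n = #(univ : Finset (Fin n)) := by simp
      _ ≤ _ := card_le_card hcover
      _ ≤ _ := (card_union_le _ _).trans (Nat.add_le_add_left ((card_union_le _ _).trans
          (Nat.add_le_add_left card_biUnion_le _)) _)
  have h2 : (n : ℝ) ≤ #{x | x ∉ Z ∧ ∀ S ∈ A, insert x S ∈ H} +
      (#Z + ∑ S ∈ A, (#{x | insert x S ∉ H} : ℝ)) := by exact_mod_cast h1
  have hn : (0 : ℝ) ≤ n := Nat.cast_nonneg n
  have h3 : ∑ S ∈ A, (#{x | insert x S ∉ H} : ℝ) ≤ (1 - α) * n := by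
    rcases A.eq_empty_or_nonempty with rfl | ⟨S₀, hS₀⟩
    · have hαn : α * n ≤ n := by
        have hle : (minCodegree k H : ℝ) ≤ n := by
          by_cases hex : ∃ S : Finset (Fin n), #S = k - 1
          · obtain ⟨S, hS⟩ := hex
            exact_mod_cast (minCodegree_le_card hk hS).trans
              ((card_filter_le _ _).trans (by simp))
          · have : minCodegree k H = 0 := by
              rw [minCodegree, minDegree, Nat.sInf_eq_zero]
              right
              ext m
              simp only [Set.mem_ofPred_eq, Set.mem_empty_iff_false, iff_false]
              rintro ⟨S, hS, -⟩
              exact hex ⟨S, hS⟩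
            rw [this]
            exact_mod_cast Nat.zero_le n
        have hc1 : c ≤ 1 := by rw [hc]; exact inv_le_one_of_one_le₀ hD0
        nlinarith
      simp only [sum_empty]
      linarith
    · have hnn : 0 ≤ (c - α) * n := le_trans (Nat.cast_nonneg _) (hcompl S₀ hS₀)
      calc _ ≤ ∑ _S ∈ A, (c - α) * n := sum_le_sum hcompl
        _ = #A * ((c - α) * n) := by rw [sum_const, nsmul_eq_mul]
        _ ≤ D * ((c - α) * n) :=
          mul_le_mul_of_nonneg_right (by exact_mod_cast hAD) hnn
        _ = n - D * α * n := by rw [hc]; field_simp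
        _ ≤ (1 - α) * n := by nlinarith [mul_nonneg hα hn]
  linarith

end Degree

section BlockCount
variable {n k h : ℕ} {H : Set (Finset (Fin n))}

-- Either case of `BlockStep` imposes at most `(h - 1).choose (k - 1)` codegree conditions. In the
-- link case they concern the sets `insert v S`, whose size is `k - 1` because `v ∉ l`.
open Classical in
lemma card_blockStep_ge {c α : ℝ} (hk : 2 ≤ k) (hkh : k ≤ h)
    (hc : c = ((h - 1).choose (k - 1) : ℝ)⁻¹) (hα : 0 ≤ α)
    (hdeg : (1 - c + α) * (n : ℝ) ≤ minCodegree k H) (P : List (Fin n)) (v : Fin n)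
    {l : List (Fin n)} (hl : v ∉ l) :
    α * n - (P.length + l.length + 1) ≤ #{x | BlockStep H k h P v x l} := by
  have hD : 1 ≤ (h - 1).choose (k - 1) := Nat.choose_pos (by omega)
  have hcard_take : ∀ (m : ℕ) (l' : List (Fin n)), #(l'.take m).toFinset ≤ m := fun m l' =>
    (List.toFinset_card_le _).trans (List.length_take_le _ _)
  have key : ∀ A : Finset (Finset (Fin n)), (∀ S ∈ A, #S = k - 1) →
      #A ≤ (h - 1).choose (k - 1) →
      (∀ x, x ∉ l → x ∉ P → x ≠ v → (∀ S ∈ A, insert x S ∈ H) → BlockStep H k h P v x l) →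
      α * n - (P.length + l.length + 1) ≤ (#{x | BlockStep H k h P v x l} : ℝ) := by
    intro A hA hAD hstep
    have h1 := card_common_neighbors_ge (by omega) hD hc hα hdeg A hA hAD
      (insert v (P.toFinset ∪ l.toFinset))
    have h2 : #(insert v (P.toFinset ∪ l.toFinset)) ≤ P.length + l.length + 1 :=
      (card_insert_le _ _).trans (Nat.succ_le_succ ((card_union_le _ _).trans
        (Nat.add_le_add (List.toFinset_card_le _) (List.toFinset_card_le _))))
    have h3 : (#(insert v (P.toFinset ∪ l.toFinset)) : ℝ) ≤ P.length + l.length + 1 := by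
      exact_mod_cast h2
    refine le_trans (by linarith) (h1.trans ?_)
    refine Nat.cast_le.2 (card_le_card fun x hx => ?_)
    simp only [mem_filter, mem_univ, true_and, mem_insert, mem_union, List.mem_toFinset,
      not_or] at hx ⊢
    exact hstep x hx.1.2.2 hx.1.2.1 hx.1.1 hx.2
  rcases Nat.lt_or_ge l.length h with hlt | hge
  · refine key (powersetCard (k - 1) ((l ++ P).take (h - 1)).toFinset) ?_ ?_ ?_
    · exact fun S hS => (mem_powersetCard.1 hS).2
    · rw [card_powersetCard]
      exact Nat.choose_le_choose _ (hcard_take _ _)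
    · intro x h1 h2 h3 h4
      refine ⟨h1, h2, h3, fun _ S hS hSc => h4 S (mem_powersetCard.2 ⟨hS, hSc⟩), fun h => ?_⟩
      omega
  · have hv : ∀ S ∈ powersetCard (k - 2) (l.take (h - 2)).toFinset, v ∉ S := by
      intro S hS hvS
      exact hl (List.mem_of_mem_take (List.mem_toFinset.1 ((mem_powersetCard.1 hS).1 hvS)))
    refine key ((powersetCard (k - 2) (l.take (h - 2)).toFinset).image (insert v)) ?_ ?_ ?_
    · intro S hS
      obtain ⟨S', hS', rfl⟩ := mem_image.1 hS
      rw [card_insert_of_notMem (hv S' hS'), (mem_powersetCard.1 hS').2]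
      omega
    · refine card_image_le.trans ?_
      rw [card_powersetCard]
      refine (Nat.choose_le_choose _ (hcard_take _ _)).trans ?_
      obtain ⟨k', rfl⟩ : ∃ k', k = k' + 2 := ⟨k - 2, by omega⟩
      obtain ⟨h', rfl⟩ : ∃ h', h = h' + 2 := ⟨h - 2, by omega⟩
      simp only [Nat.add_sub_cancel, show h' + 2 - 1 = h' + 1 by omega,
        show k' + 2 - 1 = k' + 1 by omega, Nat.choose_succ_succ]
      omega
    · intro x h1 h2 h3 h4
      refine ⟨h1, h2, h3, fun h => by omega, fun _ S hS hSc => ?_⟩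
      have := h4 (insert v S) (mem_image_of_mem _ (mem_powersetCard.2 ⟨hS, hSc⟩))
      rwa [insert_comm] at this

open Classical in
/-- A positive proportion of all tuples are blocks that absorb `v`. -/
lemma card_blocks_ge {c α : ℝ} (hk : 2 ≤ k) (hkh : k ≤ h)
    (hc : c = ((h - 1).choose (k - 1) : ℝ)⁻¹) (hα : 0 ≤ α)
    (hdeg : (1 - c + α) * (n : ℝ) ≤ minCodegree k H) (P : List (Fin n)) (v : Fin n) (m : ℕ)
    (hP : (P.length : ℝ) + m + 1 ≤ α / 2 * n) :
    (α / 2) ^ m * (n : ℝ) ^ m ≤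
      #{b : Fin m → Fin n | SuffixChain (BlockStep H k h P v) (List.ofFn b)} := by
  rw [← mul_pow]
  refine pow_le_card_suffixChain (by positivity) m fun l hl hchain => ?_
  have h1 := card_blockStep_ge hk hkh hc hα hdeg P v (notMem_of_blockStep hchain).1
  have h2 : (l.length : ℝ) ≤ m := by exact_mod_cast hl.le
  linarith

end BlockCount

/-! ### Choosing blocks by vertex weights -/

section Selection
variable {n k h M : ℕ} {H G : Set (Finset (Fin n))} {β : ℝ}

lemma suffixChain_extends_of_pathEdges (hk : 1 ≤ k) (hh : 1 ≤ h) {b : Fin M → Fin n}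
    (hb : b.Injective) (hG : ∀ e ∈ pathEdges k h M, e.image b ∈ G) :
    SuffixChain (Extends G (k - 1) (h - 1)) (List.ofFn b) := by
  refine SuffixChain.of_getElem fun i hi S hS hc => ?_
  rw [List.length_ofFn] at hi
  rw [List.getElem_ofFn]
  have hmem : ∀ y ∈ S, ∃ j : Fin M, i < j ∧ (j : ℕ) < i + h ∧ b j = y := by
    intro y hy
    have hy' := List.mem_toFinset.1 (hS hy)
    obtain ⟨a, ha, rfl⟩ := List.getElem_of_mem hy'
    simp only [List.length_take, List.length_drop, List.length_ofFn] at ha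
    refine ⟨⟨i + 1 + a, by omega⟩, by simp; omega, by simp; omega, ?_⟩
    simp
  set e := insert (⟨i, hi⟩ : Fin M)
    (univ.filter fun j : Fin M => (i < j ∧ (j : ℕ) < i + h) ∧ b j ∈ S) with he
  have himage : e.image b = insert (b ⟨i, hi⟩) S := by
    rw [he, image_insert]
    congr 1
    ext y
    simp only [mem_image, mem_filter, mem_univ, true_and]
    constructor
    · rintro ⟨j, ⟨-, hj⟩, rfl⟩
      exact hj
    · intro hy
      obtain ⟨j, h1, h2, rfl⟩ := hmem y hy
      exact ⟨j, ⟨⟨h1, h2⟩, hy⟩, rfl⟩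
  rw [← himage]
  refine hG e (mem_filter.2 ⟨mem_univ _, ?_, ?_⟩)
  · rw [← card_image_of_injective e hb, himage, card_insert_of_notMem, hc]
    · omega
    · intro hmem'
      obtain ⟨j, h1, -, h3⟩ := hmem _ hmem'
      have := congrArg Fin.val (hb h3)
      simp at this
      omega
  · have hrange : ∀ a ∈ e, i ≤ (a : ℕ) ∧ (a : ℕ) < i + h := by
      intro a ha
      rcases mem_insert.1 ha with rfl | ha
      · simp; omega
      · have := (mem_filter.1 ha).2.1
        omega
    intro a ha c hc'
    have h1 := hrange a ha
    have h2 := hrange c hc'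
    omega

/-- The weight of a vertex halves with each block that absorbs it. -/
noncomputable def absorberWeight (H : Set (Finset (Fin n))) (k h : ℕ) (L : List (Fin M → Fin n))
    (v : Fin n) : ℝ := (1 / 2) ^ #(absorbers H k h v (L.map List.ofFn))

/-- The total weight of all vertices. -/
noncomputable def totalWeight (H : Set (Finset (Fin n))) (k h : ℕ) (L : List (Fin M → Fin n)) : ℝ :=
  ∑ v, absorberWeight H k h L v

open Classical in
/-- The weight of the vertices that the block `b` absorbs if it is put in front of `L`. -/
noncomputable def absorbedWeight (H : Set (Finset (Fin n))) (k h : ℕ) (L : List (Fin M → Fin n))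
    (b : Fin M → Fin n) : ℝ :=
  ∑ v, if SuffixChain (BlockStep H k h (L.map List.ofFn).flatten v) (List.ofFn b)
    then absorberWeight H k h L v else 0

open Classical in
/-- The blocks that absorb at least a `β / 2` proportion of the total weight. -/
noncomputable def heavyBlocks (H : Set (Finset (Fin n))) (k h : ℕ) (β : ℝ)
    (L : List (Fin M → Fin n)) : Finset (Fin M → Fin n) :=
  {b | β / 2 * totalWeight H k h L ≤ absorbedWeight H k h L b}

lemma absorberWeight_pos (L : List (Fin M → Fin n)) (v : Fin n) :
    0 < absorberWeight H k h L v := by unfold absorberWeight; positivity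

lemma totalWeight_pos (hn : 0 < n) (L : List (Fin M → Fin n)) : 0 < totalWeight H k h L :=
  sum_pos (fun v _ => absorberWeight_pos L v) ⟨⟨0, hn⟩, mem_univ _⟩

lemma absorbedWeight_le (L : List (Fin M → Fin n)) (b : Fin M → Fin n) :
    absorbedWeight H k h L b ≤ totalWeight H k h L :=
  sum_le_sum fun v _ => by
    split_ifs
    · exact le_rfl
    · exact (absorberWeight_pos L v).le

lemma exists_absorbed_of_mem_heavyBlocks (hn : 0 < n) (hβ : 0 < β) {L : List (Fin M → Fin n)}
    {b : Fin M → Fin n} (hb : b ∈ heavyBlocks H k h β L) :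
    ∃ v, SuffixChain (BlockStep H k h (L.map List.ofFn).flatten v) (List.ofFn b) := by
  by_contra! hcon
  have h1 := (mem_filter.1 hb).2
  have h2 : absorbedWeight H k h L b = 0 := sum_eq_zero fun v _ => if_neg (hcon v)
  have h3 := mul_pos (half_pos hβ) (totalWeight_pos (H := H) (k := k) (h := h) hn L)
  linarith

lemma injective_of_mem_heavyBlocks (hn : 0 < n) (hβ : 0 < β) {L : List (Fin M → Fin n)}
    {b : Fin M → Fin n} (hb : b ∈ heavyBlocks H k h β L) : b.Injective := by
  obtain ⟨v, hv⟩ := exists_absorbed_of_mem_heavyBlocks hn hβ hb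
  exact List.nodup_ofFn.1 (nodup_of_blockStep hv)

lemma totalWeight_cons (L : List (Fin M → Fin n)) (b : Fin M → Fin n) :
    totalWeight H k h (b :: L) = totalWeight H k h L - absorbedWeight H k h L b / 2 := by
  rw [totalWeight, totalWeight, absorbedWeight, sum_div, ← sum_sub_distrib]
  refine sum_congr rfl fun v _ => ?_
  rw [absorberWeight, absorberWeight, List.map_cons]
  split_ifs with hv
  · rw [card_absorbers_cons_of_suffixChain hv, pow_succ]
    ring
  · rw [card_absorbers_cons_of_not_suffixChain hv]
    ring

-- Double counting: the average absorbed weight is at least `β` times the total. Light blocks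
-- account for at most half of that, and a heavy block absorbs at most the whole weight.
open Classical in
lemma card_heavyBlocks_ge (hn : 0 < n) {L : List (Fin M → Fin n)}
    (hβ : ∀ v, β * (n : ℝ) ^ M ≤ #{b : Fin M → Fin n |
      SuffixChain (BlockStep H k h (L.map List.ofFn).flatten v) (List.ofFn b)})
    (hβ0 : 0 ≤ β) : β / 2 * (n : ℝ) ^ M ≤ #(heavyBlocks H k h β L) := by
  set W := totalWeight H k h L with hW
  have hW0 : 0 < W := totalWeight_pos hn L
  have h1 : β * (n : ℝ) ^ M * W ≤ ∑ b : Fin M → Fin n, absorbedWeight H k h L b := by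
    simp only [absorbedWeight]
    rw [sum_comm, hW, totalWeight, mul_sum]
    refine sum_le_sum fun v _ => ?_
    rw [← sum_filter, sum_const, nsmul_eq_mul]
    exact mul_le_mul_of_nonneg_right (hβ v) (absorberWeight_pos L v).le
  have h2 : ∑ b : Fin M → Fin n, absorbedWeight H k h L b ≤
      #(heavyBlocks H k h β L) * W + (n : ℝ) ^ M * (β / 2 * W) := by
    rw [← sum_filter_add_sum_filter_not univ (fun b : Fin M → Fin n => b ∈ heavyBlocks H k h β L)]
    refine add_le_add ?_ ?_
    · rw [filter_mem_eq_inter, univ_inter, ← nsmul_eq_mul]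
      exact sum_le_card_nsmul _ _ _ fun b _ => absorbedWeight_le L b
    · refine (sum_le_card_nsmul _ _ (β / 2 * W) fun b hb => ?_).trans ?_
      · have hb' := (mem_filter.1 hb).2
        simp only [heavyBlocks, mem_filter, mem_univ, true_and, not_le] at hb'
        exact hb'.le
      · rw [nsmul_eq_mul]
        refine mul_le_mul_of_nonneg_right ?_ (by positivity)
        exact_mod_cast (card_filter_le _ _).trans (by simp)
  refine le_of_mul_le_mul_right ?_ hW0
  linarith

lemma exists_validBlocks (hk : 1 ≤ k) (hh : 1 ≤ h) (hn : 0 < n) (hβ : 0 < β) (hβ1 : β ≤ 1)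
    (hM : M = 3 * h) (N : ℕ)
    (hstep : ∀ L : List (Fin M → Fin n), L.length < N →
      ∃ b ∈ heavyBlocks H k h β L, ∀ e ∈ pathEdges k h M, e.image b ∈ G) :
    ∃ L : List (Fin M → Fin n), L.length = N ∧ ValidBlocks H G k h (L.map List.ofFn) ∧
      totalWeight H k h L ≤ (1 - β / 4) ^ N * n := by
  induction N with
  | zero => exact ⟨[], rfl, trivial, by simp [totalWeight, absorberWeight, absorbers]⟩
  | succ N ih =>
    obtain ⟨L, hL, hval, hw⟩ := ih fun L hL => hstep L (by omega)
    obtain ⟨b, hb, hbG⟩ := hstep L (by omega)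
    refine ⟨b :: L, by simp [hL], ⟨⟨by simp [hM], ?_, ?_⟩, hval⟩, ?_⟩
    · exact suffixChain_extends_of_pathEdges hk hh (injective_of_mem_heavyBlocks hn hβ hb) hbG
    · exact exists_absorbed_of_mem_heavyBlocks hn hβ hb
    -- Half of the absorbed weight disappears, which is at least a `β / 4` share of the total.
    · rw [totalWeight_cons, pow_succ]
      have h1 := (mem_filter.1 hb).2
      have h2 := mul_le_mul_of_nonneg_left hw (by linarith : 0 ≤ 1 - β / 4)
      linarith

/-- A single weight is at most the total; taking logarithms gives the bound, using `log 2 ≤ 1`. -/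
lemma card_absorbers_ge (hn : 0 < n) (hβ1 : β ≤ 1) {N : ℕ} {L : List (Fin M → Fin n)}
    (hw : totalWeight H k h L ≤ (1 - β / 4) ^ N * n) (v : Fin n) :
    β / 4 * N - Real.log n ≤ #(absorbers H k h v (L.map List.ofFn)) := by
  set a := #(absorbers H k h v (L.map List.ofFn)) with ha
  have hn0 : (0 : ℝ) < n := by exact_mod_cast hn
  have h1 : (1 / 2 : ℝ) ^ a ≤ Real.exp (-(β / 4) * N) * n := by
    calc (1 / 2 : ℝ) ^ a = absorberWeight H k h L v := rfl
      _ ≤ totalWeight H k h L :=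
        single_le_sum (f := absorberWeight H k h L) (fun v _ => (absorberWeight_pos L v).le)
          (mem_univ v)
      _ ≤ (1 - β / 4) ^ N * n := hw
      _ ≤ _ := by
        refine mul_le_mul_of_nonneg_right ?_ hn0.le
        rw [mul_comm, Real.exp_nat_mul]
        refine pow_le_pow_left₀ (by linarith) ?_ _
        have := Real.add_one_le_exp (-(β / 4))
        linarith
  have h2 := Real.log_le_log (by positivity) h1
  rw [Real.log_mul (Real.exp_pos _).ne' hn0.ne', Real.log_exp, Real.log_pow, one_div,
    Real.log_inv] at h2
  have h3 : Real.log 2 ≤ 1 := by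
    have := Real.log_two_lt_d9
    linarith
  have h4 : (a : ℝ) * Real.log 2 ≤ a := mul_le_of_le_one_right (Nat.cast_nonneg _) h3
  linarith

end Selection

/-! ### Union bound over all histories -/

section UnionBound

instance isProbabilityMeasure_binomialRandom (V : Type*) (k : ℕ) (p : unitInterval) :
    MeasureTheory.IsProbabilityMeasure (binomialRandom V k p) := by
  unfold binomialRandom
  infer_instance

variable {n k h M : ℕ} {H : Set (Finset (Fin n))} {β C : ℝ}

/-- Heavy blocks depend on `H` and `L` but not on `G`, so `hfail` treats a fixed list. Covering
every list shorter than `N` makes it harmless that the actual list is chosen after seeing `G`. -/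
lemma binomialRandom_exists_heavy_ge (hn : 0 < n) {p : unitInterval} (N : ℕ)
    (hfail : ∀ L : List (Fin M → Fin n), L.length < N → (binomialRandom (Fin n) k p).real
      {G | ∀ t ∈ heavyBlocks H k h β L, ¬ ∀ e ∈ pathEdges k h M, e.image t ∈ G} ≤ C) :
    1 - (N : ℝ) * ((n : ℝ) ^ M) ^ N * C ≤ (binomialRandom (Fin n) k p).real
      {G | ∀ L : List (Fin M → Fin n), L.length < N →
        ∃ b ∈ heavyBlocks H k h β L, ∀ e ∈ pathEdges k h M, e.image b ∈ G} := by
  set μ := binomialRandom (Fin n) k p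
  -- A history is coded as a full `N`-tuple with a truncation point, which makes the count `N * (n ^
  -- M) ^ N`.
  let hist : Fin N × (Fin N → Fin M → Fin n) → List (Fin M → Fin n) :=
    fun x => (List.ofFn x.2).take x.1
  have hlen : ∀ x, (hist x).length < N := by
    intro x
    simp only [hist, List.length_take, List.length_ofFn]
    omega
  have hsurj : ∀ L : List (Fin M → Fin n), L.length < N → ∃ x, hist x = L := by
    intro L hL
    refine ⟨(⟨L.length, hL⟩, fun i => L.getD i fun _ => ⟨0, hn⟩), ?_⟩
    refine List.ext_getElem (by simp [hist]; omega) fun i h1 h2 => ?_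
    simp [hist, h2]
  set good := {G : Set (Finset (Fin n)) | ∀ L : List (Fin M → Fin n), L.length < N →
        ∃ b ∈ heavyBlocks H k h β L, ∀ e ∈ pathEdges k h M, e.image b ∈ G} with hgood
  let bad : Fin N × (Fin N → Fin M → Fin n) → Set (Set (Finset (Fin n))) := fun x =>
    {G | ∀ t ∈ heavyBlocks H k h β (hist x), ¬ ∀ e ∈ pathEdges k h M, e.image t ∈ G}
  have hcover : (Set.univ : Set (Set (Finset (Fin n)))) ⊆ good ∪ ⋃ x, bad x := by
    intro G _
    by_cases hG : G ∈ good
    · exact Or.inl hG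
    · right
      simp only [hgood, Set.mem_ofPred_eq] at hG
      push Not at hG
      obtain ⟨L, hL, hLb⟩ := hG
      obtain ⟨x, rfl⟩ := hsurj L hL
      refine Set.mem_iUnion.2 ⟨x, fun t ht hcon => ?_⟩
      obtain ⟨e, he, he'⟩ := hLb t ht
      exact he' (hcon e he)
  have h1 : 1 ≤ μ.real good + μ.real (⋃ x, bad x) := by
    calc (1 : ℝ) = μ.real Set.univ := by simp
      _ ≤ μ.real (good ∪ ⋃ x, bad x) := MeasureTheory.measureReal_mono hcover
      _ ≤ _ := MeasureTheory.measureReal_union_le _ _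
  have h2 : μ.real (⋃ x, bad x) ≤ ∑ x, μ.real (bad x) :=
    MeasureTheory.measureReal_iUnion_fintype_le _
  have h3 : ∑ x, μ.real (bad x) ≤ (N : ℝ) * ((n : ℝ) ^ M) ^ N * C := by
    refine (sum_le_card_nsmul _ _ C fun x _ => hfail _ (hlen x)).trans ?_
    rw [nsmul_eq_mul, card_univ]
    simp
  linarith

end UnionBound

/-! ### Asymptotic estimates -/

section Asymptotics
open Filter Topology Real

lemma eventually_union_bound_le {C η : ℝ} (hC : 0 < C) (hη : 0 < η) (M : ℕ) :
    ∀ᶠ n : ℕ in atTop, ∀ N : ℕ, N ≤ n →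
      (N : ℝ) * ((n : ℝ) ^ M) ^ N * exp (-(C * (n : ℝ) ^ (5 / 4 : ℝ))) ≤ η := by
  have hδ : 0 < C / (2 * ((M : ℝ) + 1)) := by positivity
  have hlog : ∀ᶠ n : ℕ in atTop,
      ‖log n‖ ≤ C / (2 * ((M : ℝ) + 1)) * ‖(n : ℝ) ^ (1 / 4 : ℝ)‖ :=
    tendsto_natCast_atTop_atTop.eventually
      ((isLittleO_log_rpow_atTop (by norm_num : (0 : ℝ) < 1 / 4)).bound hδ)
  have hexp : Tendsto (fun n : ℕ => exp (-(C / 2 * (n : ℝ) ^ (5 / 4 : ℝ)))) atTop (𝓝 0) := by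
    refine tendsto_exp_neg_atTop_nhds_zero.comp (Tendsto.const_mul_atTop (half_pos hC) ?_)
    exact (tendsto_rpow_atTop (by norm_num)).comp tendsto_natCast_atTop_atTop
  filter_upwards [hlog, hexp.eventually_le_const hη, eventually_ge_atTop 1] with n h1 h2 hn N hN
  have hn1 : (1 : ℝ) ≤ n := by exact_mod_cast hn
  have hn0 : (0 : ℝ) < n := by linarith
  refine le_trans ?_ h2
  have hlog0 : 0 ≤ log n := log_nonneg hn1
  rw [norm_of_nonneg hlog0, norm_of_nonneg (rpow_nonneg hn0.le _)] at h1
  have h3 : (N : ℝ) * ((n : ℝ) ^ M) ^ N ≤ exp (((M : ℝ) + 1) * n * log n) := by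
    calc (N : ℝ) * ((n : ℝ) ^ M) ^ N ≤ (n : ℝ) ^ n * ((n : ℝ) ^ M) ^ n := by
          refine mul_le_mul ?_ (pow_le_pow_right₀ (one_le_pow₀ hn1) hN) (by positivity)
            (by positivity)
          calc (N : ℝ) ≤ n := by exact_mod_cast hN
            _ ≤ (n : ℝ) ^ n := le_self_pow₀ hn1 (by omega)
      _ = exp (((M : ℝ) + 1) * n * log n) := by
          rw [← pow_mul, ← pow_add, ← exp_log (pow_pos hn0 (n + M * n)), log_pow]
          push_cast
          ring_nf
  have h4 : ((M : ℝ) + 1) * n * log n ≤ C / 2 * (n : ℝ) ^ (5 / 4 : ℝ) := by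
    calc ((M : ℝ) + 1) * n * log n
        ≤ ((M : ℝ) + 1) * n * (C / (2 * ((M : ℝ) + 1)) * (n : ℝ) ^ (1 / 4 : ℝ)) :=
          mul_le_mul_of_nonneg_left h1 (by positivity)
      _ = C / 2 * ((n : ℝ) ^ (1 : ℝ) * (n : ℝ) ^ (1 / 4 : ℝ)) := by
          rw [rpow_one]; field_simp
      _ = _ := by rw [← rpow_add hn0]; norm_num
  calc _ ≤ exp (((M : ℝ) + 1) * n * log n) * exp (-(C * (n : ℝ) ^ (5 / 4 : ℝ))) :=
        mul_le_mul_of_nonneg_right h3 (exp_pos _).le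
    _ ≤ _ := by
        rw [← exp_add]
        exact exp_le_exp.2 (by linarith)

lemma eventually_log_add_le (A : ℝ) {δ : ℝ} (hδ : 0 < δ) :
    ∀ᶠ n : ℕ in atTop, log n + A ≤ δ * n := by
  have h1 : ∀ᶠ n : ℕ in atTop, ‖log n‖ ≤ δ / 2 * ‖(n : ℝ)‖ :=
    tendsto_natCast_atTop_atTop.eventually (isLittleO_log_id_atTop.bound (half_pos hδ))
  have h2 : ∀ᶠ n : ℕ in atTop, A ≤ δ / 2 * n :=
    (Tendsto.const_mul_atTop (half_pos hδ) tendsto_natCast_atTop_atTop).eventually_ge_atTop A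
  filter_upwards [h1, h2] with n h1 h2
  have h3 := le_norm_self (log n)
  rw [norm_of_nonneg (Nat.cast_nonneg n : (0 : ℝ) ≤ n)] at h1
  linarith

end Asymptotics

end PerturbedHypergraph

/-! ### Choice of constants and conclusion -/

theorem lemma3p2 (k r : ℕ) (hk : 2 ≤ k) (hr : 1 ≤ r) (hkr : 4 ≤ k + r)
    (h : ℕ) (hh : h = k + r - 1) (c : ℝ) (hc : c = ((k + r - 2).choose (k - 1) : ℝ)⁻¹) :
    ∃ α₀ : ℝ, 0 < α₀ ∧ ∀ α : ℝ, 0 < α → α ≤ α₀ →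
    ∃ ζ₀ : ℝ, 0 < ζ₀ ∧ ∀ ζ : ℝ, 0 < ζ → ζ ≤ ζ₀ →
    ∃ ε₀ : ℝ, 0 < ε₀ ∧ ∀ ε : ℝ, 0 < ε → ε ≤ ε₀ →
    ∀ η : ℝ, 0 < η → ∃ n₀ : ℕ, ∀ n : ℕ, n₀ ≤ n →
    ∀ H : Set (Finset (Fin n)), H.Sized k →
    (1 - c + α) * (n : ℝ) ≤ (PerturbedHypergraph.minCodegree k H : ℝ) →
    ∀ p : unitInterval, (n : ℝ) ^ (-c - ε) ≤ (p : ℝ) →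
    1 - η ≤ (PerturbedHypergraph.binomialRandom (Fin n) k p).real
      {G | ∃ P : List (Fin n), (P.length : ℝ) ≤ 6 * (h : ℝ) * ζ * (n : ℝ) ∧
        PerturbedHypergraph.IsAbsorbingPath r k (H ∪ G)
          (ζ ^ 2 * (n : ℝ) / (2 * (h : ℝ)) ^ 2) P} := by
  have hh3 : 3 ≤ h := by omega
  have hkh : k ≤ h := by omega
  have hh3' : (3 : ℝ) ≤ h := by exact_mod_cast hh3
  rw [show k + r - 2 = h - 1 by omega] at hc
  set D := (h - 1).choose (k - 1) with hD
  have hD0 : (0 : ℝ) < D := by exact_mod_cast Nat.choose_pos (by omega)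
  refine ⟨1, one_pos, fun α hα hα1 => ?_⟩
  set β : ℝ := (α / 2) ^ (3 * h) with hβ
  have hβ0 : 0 < β := by positivity
  have hβ1 : β ≤ 1 := pow_le_one₀ (by positivity) (by linarith)
  -- The first bound keeps the path within `α / 4 * n` vertices, leaving room for the greedy count.
  -- The second gives `ζ ^ 2 * n ≤ β / 8 * (ζ * n)`, half of the main term `β / 4 * (ζ * n)` for the
  -- absorbers.
  refine ⟨min (α / (12 * h)) (β / 8), by positivity, fun ζ hζ hζ0 => ?_⟩
  have hζα : 3 * h * ζ ≤ α / 4 := by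
    have := hζ0.trans (min_le_left _ _)
    rw [le_div_iff₀ (by positivity)] at this
    linarith
  have hζβ : ζ ≤ β / 8 := hζ0.trans (min_le_right _ _)
  have hζ1 : ζ ≤ 1 := by linarith
  -- A block has at most `D * (3 * h)` path edges, so `ε` costs at most `1 / 4` in the exponent of
  -- `n`.
  refine ⟨1 / (4 * D * ((3 * h : ℕ) : ℝ)), by positivity, fun ε hε hε0 η hη => ?_⟩
  have hεD : ε * D * ((3 * h : ℕ) : ℝ) ≤ 1 / 4 := by
    rw [le_div_iff₀ (by positivity)] at hε0
    linarith
  set C : ℝ := β / 2 / (2 * (((3 * h : ℕ) : ℝ) + 1) ^ (3 * h)) with hC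
  have hC0 : 0 < C := by positivity
  obtain ⟨n₀, hn₀⟩ := Filter.eventually_atTop.1
    ((PerturbedHypergraph.eventually_union_bound_le hC0 hη (3 * h)).and
    ((PerturbedHypergraph.eventually_log_add_le (β / 4) (by positivity : 0 < β * ζ / 8)).and
    ((PerturbedHypergraph.eventually_log_add_le (3 * h + 1) (by positivity : 0 < α / 4)).and
    ((PerturbedHypergraph.eventually_log_add_le 1 hζ).and (Filter.eventually_ge_atTop 1)))))
  refine ⟨n₀, fun n hn H _ hdeg p hp => ?_⟩
  obtain ⟨hunion, hlogβ, hlogα, hlogζ, hn1⟩ := hn₀ n hn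
  have hn1' : (1 : ℝ) ≤ n := by exact_mod_cast hn1
  have hlog0 : 0 ≤ Real.log n := Real.log_nonneg hn1'
  have hp0 : (0 : ℝ) < p := (Real.rpow_pos_of_pos (by linarith) _).trans_le hp
  set N := ⌊ζ * n⌋₊ with hN
  have hNle : (N : ℝ) ≤ ζ * n := Nat.floor_le (by positivity)
  have hNge : ζ * n - 1 ≤ N := (Nat.sub_one_lt_floor _).le
  have hN0 : 0 < N := Nat.floor_pos.2 (by linarith)
  have hNn : N ≤ n := by
    have : (N : ℝ) ≤ n := hNle.trans (mul_le_of_le_one_left (by linarith) hζ1)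
    exact_mod_cast this
  have hlen : ∀ L : List (Fin (3 * h) → Fin n),
      (L.map List.ofFn).flatten.length = 3 * h * L.length := by
    intro L
    induction L with
    | nil => simp
    | cons b L ih =>
      rw [List.map_cons, List.flatten_cons, List.length_append, ih, List.length_ofFn,
        List.length_cons]
      ring
  have hfail : ∀ L : List (Fin (3 * h) → Fin n), L.length < N →
      (PerturbedHypergraph.binomialRandom (Fin n) k p).real
        {G | ∀ t ∈ PerturbedHypergraph.heavyBlocks H k h β L,
          ¬ ∀ e ∈ PerturbedHypergraph.pathEdges k h (3 * h), e.image t ∈ G} ≤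
        Real.exp (-(C * (n : ℝ) ^ (5 / 4 : ℝ))) := by
    intro L hL
    refine PerturbedHypergraph.binomialRandom_no_path_le hp0 hn1
      (PerturbedHypergraph.rpow_le_of_density hk hkh hh3 hc hε.le hεD hn1 hp) _
      (fun t ht => PerturbedHypergraph.injective_of_mem_heavyBlocks hn1 hβ0 ht) ?_
    refine PerturbedHypergraph.card_heavyBlocks_ge hn1 (fun v => ?_) hβ0.le
    refine PerturbedHypergraph.card_blocks_ge hk hkh hc hα.le hdeg _ v _ ?_
    rw [hlen]
    have h1 : (L.length : ℝ) ≤ ζ * n := le_trans (by exact_mod_cast hL.le) hNle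
    have h2 : 3 * h * (L.length : ℝ) ≤ 3 * h * (ζ * n) :=
      mul_le_mul_of_nonneg_left h1 (by positivity)
    have h3 : 3 * h * ζ * n ≤ α / 4 * n := mul_le_mul_of_nonneg_right hζα (by linarith)
    push_cast
    linarith
  have hprob := PerturbedHypergraph.binomialRandom_exists_heavy_ge hn1 N hfail
  have hη' := hunion N hNn
  refine le_trans (by linarith) (hprob.trans (MeasureTheory.measureReal_mono ?_))
  intro G hG
  obtain ⟨L, hLN, hval, hw⟩ := PerturbedHypergraph.exists_validBlocks (by omega : 1 ≤ k)
    (by omega : 1 ≤ h) hn1 hβ0 hβ1 rfl N hG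
  refine ⟨(L.map List.ofFn).flatten, ?_, ?_⟩
  · rw [hlen, hLN]
    push_cast
    have : 3 * h * (N : ℝ) ≤ 3 * h * (ζ * n) := mul_le_mul_of_nonneg_left hNle (by positivity)
    have h2 : 0 ≤ 3 * h * (ζ * n) := by positivity
    linarith
  · refine PerturbedHypergraph.isAbsorbingPath_of_validBlocks hk (by omega) hh hval ?_ fun v => ?_
    · rw [Ne, List.map_eq_nil_iff, ← List.length_eq_zero_iff, hLN]
      exact hN0.ne'
    · refine le_trans ?_ (PerturbedHypergraph.card_absorbers_ge hn1 hβ1 hw v)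
      have h1 : ζ ^ 2 * n / (2 * (h : ℝ)) ^ 2 ≤ ζ ^ 2 * n :=
        div_le_self (by positivity) (one_le_pow₀ (by linarith))
      have h2 : ζ ^ 2 * n ≤ β / 8 * (ζ * n) := by
        rw [sq, mul_assoc]
        exact mul_le_mul_of_nonneg_right hζβ (by positivity)
      have h3 : β / 4 * (ζ * n - 1) ≤ β / 4 * N := mul_le_mul_of_nonneg_left hNge (by positivity)
      linarith
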